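/- Let $n\ge 0$ be an integer. Let $q,a_1,a_2,b_1,b_2\in\mathbb C^*$ with $|q|<1$, let $\alpha,\tau\in\mathbb C$, fix the principal logarithm of $q$ to define $q^c$ for $c\in\mathbb C$, and put $t=q^\tau$. Write $(x;c)_k=\prod_{i=0}^{k-1}(1-c^ix)$, $(x;q)_\infty=\prod_{i\ge0}(1-q^ix)$, $\begin{bmatrix} i\\ j\end{bmatrix}_t=\frac{(t;t)_i}{(t;t)_{i-j}(t;t)_j}$ and $\Delta(z)=\prod_{1\le i<j\le n}(z_i-z_j)$. Let $$\Phi(z)=\prod_{i=1}^n z_i^\alpha\,\frac{(qa_1^{-1}z_i;q)_\infty(qa_2^{-1}z_i;q)_\infty}{(b_1z_i;q)_\infty(b_2z_i;q)_\infty}\ \prod_{1\le j<k\le n}z_j^{2\tau-1}\frac{(qt^{-1}z_k/z_j;q)_\infty}{(tz_k/z_j;q)_\infty},$$ let $e_i(a,b;z)$ $(0\le i\le n)$ be Matsuo's polynomials $$e_i(a,b;z)=\frac1{\Delta(z)}\sum_{\sigma\in S_n}\operatorname{sgn}(\sigma)\,F_i(z_{\sigma(1)},\dots,z_{\sigma(n)}),\qquad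 F_i(z)=\prod_{j=1}^{n-i}(1-bz_j)\prod_{j=n-i+1}^n(1-a^{-1}z_j)\prod_{1\le k<l\le n}(z_k-t^{-1}z_l),$$ and for $\xi\in(\mathbb C^*)^n$ let $$\langle e_i(a,b),\xi\rangle=(1-q)^n\sum_{\nu\in\mathbb Z^n}\big(e_i(a,b;z)\Phi(z)\Delta(z)\big)\Big|_{z=(\xi_1q^{\nu_1},\dots,\xi_nq^{\nu_n})},$$ where powers on the lattice are taken as $(\xi_iq^{\nu_i})^c=\xi_i^c\,(q^c)^{\nu_i}$ (principal value of $\xi_i^c$). Call $\xi$ admissible if no denominator of $\Phi$ vanishes on its lattice, i.e. $b_r\xi_i\notin q^{\mathbb Z}$ for $r=1,2$ and all $i$, and $t\xi_k/\xi_j\notin q^{\mathbb Z}$ for all $j<k$. Assume that the convergence conditions $|qa_1^{-1}a_2^{-1}b_1^{-1}b_2^{-1}|<|q^{\alpha}|<1$ and $|qa_1^{-1}a_2^{-1}b_1^{-1}b_2^{-1}|<|q^{\alpha}t^{2n-2}|<1$ hold for $\alpha$ and also with $\alpha+1$ in place of $\alpha$, that $t^k\ne1$ for $1\le k\le n$,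 and that $q^\alpha a_2b_2t^m\neq1$ for $0\le m\le 2n-2$. Then there is an $(n+1)\times(n+1)$ matrix $A$, independent of $\xi$, such that for every admissible $\xi$ the series $\langle e_i(a_1,b_2),\xi\rangle$ $(0\le i\le n)$ converge absolutely both for $\alpha$ and for $\alpha+1$ and, with $T_\alpha$ the shift $\alpha\mapsto\alpha+1$, $$T_\alpha\big(\langle e_0(a_1,b_2),\xi\rangle,\dots,\langle e_n(a_1,b_2),\xi\rangle\big)=\big(\langle e_0(a_1,b_2),\xi\rangle,\dots,\langle e_n(a_1,b_2),\xi\rangle\big)A .$$ It is $A=L_AD_AU_A$ with $L_A=(l_{ij})_{0\le i,j\le n}$ lower triangular, $D_A=(d_j\delta_{ij})_{0\le i,j\le n}$ diagonal, $U_A=(u_{ij})_{0\le i,j\le n}$ upper triangular, and entries $$l_{ij}=(-1)^{i-j}t^{\binom{n-i}2-\binom{n-j}2}\begin{bmatrix} n-j\\ n-i\end{bmatrix}_t\frac{(a_2b_2t^j;t)_{i-j}}{(q^\alpha a_2b_2t^{2j};t)_{i-j}}\quad(j\le i),$$ $$d_j=a_1^{n-j}a_2^jt^{\binom j2+\binom{n-j}2}\frac{(q^\alpha;t)_j(q^\alpha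 a_2b_2t^{2j};t)_{n-j}}{(q^\alpha a_2b_2t^{j-1};t)_j(q^\alpha a_1a_2b_1b_2t^{n+j-1};t)_{n-j}},$$ $$u_{ij}=(-q^\alpha a_1^{-1}a_2)^{j-i}t^{\binom j2-\binom i2}\begin{bmatrix} j\\ i\end{bmatrix}_t\frac{(a_1b_1t^{n-j};t)_{j-i}}{(q^\alpha a_2b_2t^{2i};t)_{j-i}}\quad(i\le j),$$ and its determinant evaluates as $$\det A=d_0d_1\cdots d_n=(a_1a_2)^{\binom{n+1}2}\,t^{2\binom{n+1}3}\prod_{i=1}^n\frac{(q^\alpha;t)_i}{(q^\alpha a_1a_2b_1b_2t^{2n-i-1};t)_i}.$$ -/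

import Mathlib

open scoped BigOperators

noncomputable section

/-- The infinite shifted factorial `(x; q)_∞ = ∏_{i ≥ 0} (1 - q ^ i x)`, for `‖q‖ < 1`. -/
def qPochInf (q x : ℂ) : ℂ := ∏' i : ℕ, (1 - q ^ i * x)

/-- The shifted factorial `(x; c)_k = (1 - x)(1 - c x) ⋯ (1 - c ^ (k - 1) x)` for `k ≥ 0`. -/
def qPoch (c x : ℂ) (k : ℕ) : ℂ := ∏ i ∈ Finset.range k, (1 - c ^ i * x)

/-- The `c`-binomial coefficient `(c; c)_i / ((c; c)_{i - j} (c; c)_j)`, for `j ≤ i`. -/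
def qBinom (c : ℂ) (i j : ℕ) : ℂ := qPoch c c i / (qPoch c c (i - j) * qPoch c c j)

/-- `Δ(z) = ∏_{i < j} (z_i - z_j)`. -/
def vdm {n : ℕ} (z : Fin n → ℂ) : ℂ := ∏ i, ∏ j ∈ Finset.Ioi i, (z i - z j)

/-- The skew-symmetrization `(𝒜 f)(z) = ∑_σ sgn(σ) f(z_{σ(1)}, …, z_{σ(n)})`. -/
def skewSymm {n : ℕ} (f : (Fin n → ℂ) → ℂ) (z : Fin n → ℂ) : ℂ :=
  ∑ σ : Equiv.Perm (Fin n), ((Equiv.Perm.sign σ : ℤ) : ℂ) * f (z ∘ σ)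

/-- The function that is skew-symmetrized in the definition of Matsuo's polynomials,
`∏_{j=1}^{n-i} (1 - b z_j) ∏_{j=n-i+1}^{n} (1 - a⁻¹ z_j) ∏_{k<l} (z_k - t⁻¹ z_l)`
(the coordinates of `z` are numbered from `0` here). -/
def matsuoKernel (t a b : ℂ) {n : ℕ} (i : ℕ) (z : Fin n → ℂ) : ℂ :=
  (∏ j : Fin n, if (j : ℕ) + i < n then 1 - b * z j else 1 - a⁻¹ * z j) *
    ∏ k, ∏ l ∈ Finset.Ioi k, (z k - t⁻¹ * z l)

/-- Matsuo's polynomial `e_i(a, b; z)`, written as a quotient by `Δ(z)`. Where `Δ(z) = 0` the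
quotient takes the value `0`, but below only the product `e_i(a, b; z) Δ(z)` is used, and that
product is right for all `z`, see `matsuo_mul_vdm`. -/
def matsuo (t a b : ℂ) {n : ℕ} (i : ℕ) (z : Fin n → ℂ) : ℂ :=
  skewSymm (matsuoKernel t a b i) z / vdm z

/-- A skew-symmetrization vanishes wherever `Δ` does. -/
theorem skewSymm_eq_zero_of_vdm {n : ℕ} (f : (Fin n → ℂ) → ℂ) (z : Fin n → ℂ)
    (hz : vdm z = 0) : skewSymm f z = 0 := by
  obtain ⟨i, -, hi⟩ := Finset.prod_eq_zero_iff.1 hz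
  obtain ⟨j, hj, hij⟩ := Finset.prod_eq_zero_iff.1 hi
  have hne : i ≠ j := (Finset.mem_Ioi.1 hj).ne
  have hzz : z i = z j := sub_eq_zero.1 hij
  have hsw : z ∘ (Equiv.swap i j) = z := by
    funext k
    by_cases h1 : k = i
    · subst h1; simp [hzz]
    · by_cases h2 : k = j
      · subst h2; simp [hzz]
      · simp [Equiv.swap_apply_of_ne_of_ne h1 h2]
  have key : skewSymm f z = - skewSymm f z := by
    conv_lhs => unfold skewSymm
    rw [← Equiv.sum_comp (Equiv.mulLeft (Equiv.swap i j))]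
    unfold skewSymm
    rw [← Finset.sum_neg_distrib]
    refine Finset.sum_congr rfl fun σ _ => ?_
    have hc : z ∘ ⇑(Equiv.swap i j * σ) = z ∘ σ := by
      rw [Equiv.Perm.coe_mul, ← Function.comp_assoc, hsw]
    rw [Equiv.coe_mulLeft, hc]
    simp [Equiv.Perm.sign_mul, Equiv.Perm.sign_swap hne]
  exact self_eq_neg.1 key

theorem matsuo_mul_vdm (t a b : ℂ) {n : ℕ} (i : ℕ) (z : Fin n → ℂ) :
    matsuo t a b i z * vdm z = skewSymm (matsuoKernel t a b i) z := by
  unfold matsuo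
  by_cases h : vdm z = 0
  · rw [h, mul_zero, skewSymm_eq_zero_of_vdm _ _ h]
  · exact div_mul_cancel₀ _ h

/-- The parameters of the Jackson integral of symmetric Selberg type with `m = 2`. -/
structure SelbergParams where
  q : ℂ
  α : ℂ
  τ : ℂ
  a₁ : ℂ
  a₂ : ℂ
  b₁ : ℂ
  b₂ : ℂ

namespace SelbergParams

/-- `q ^ α`. -/
def qα (p : SelbergParams) : ℂ := p.q ^ p.α

/-- `t = q ^ τ`. -/
def t (p : SelbergParams) : ℂ := p.q ^ p.τ

/-- The shift `T_α : α ↦ α + 1`. -/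
def shift (p : SelbergParams) : SelbergParams := { p with α := p.α + 1 }

/-- The conditions on the parameters under which the Jackson integrals of Matsuo's polynomials
in `n` variables converge. -/
def Converges (p : SelbergParams) (n : ℕ) : Prop :=
  ‖p.q * p.a₁⁻¹ * p.a₂⁻¹ * p.b₁⁻¹ * p.b₂⁻¹‖ < ‖p.qα‖ ∧ ‖p.qα‖ < 1 ∧
  ‖p.q * p.a₁⁻¹ * p.a₂⁻¹ * p.b₁⁻¹ * p.b₂⁻¹‖ < ‖p.qα * p.t ^ (2 * (n : ℤ) - 2)‖ ∧
  ‖p.qα * p.t ^ (2 * (n : ℤ) - 2)‖ < 1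

/-- The point `(ξ_1 q ^ ν_1, …, ξ_n q ^ ν_n)` of the lattice through `ξ`. -/
def pt (p : SelbergParams) {n : ℕ} (ξ : Fin n → ℂ) (ν : Fin n → ℤ) : Fin n → ℂ :=
  fun i => ξ i * p.q ^ ν i

/-- The value of the power `z ^ c` at `z = x q ^ m`, in the branch along the lattice `x q ^ ℤ` for
which `z ^ c` is multiplied by `q ^ c` under `z ↦ q z`. -/
def latPow (p : SelbergParams) (x : ℂ) (m : ℤ) (c : ℂ) : ℂ := x ^ c * (p.q ^ c) ^ m

/-- The function `Φ` at the lattice point `z = (ξ_1 q ^ ν_1, …, ξ_n q ^ ν_n)`: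
`∏_i z_i ^ α (q z_i / a₁)_∞ (q z_i / a₂)_∞ / ((b₁ z_i)_∞ (b₂ z_i)_∞)` times
`∏_{j<k} z_j ^ (2 τ - 1) (q t⁻¹ z_k / z_j)_∞ / (t z_k / z_j)_∞`. -/
def Phi (p : SelbergParams) {n : ℕ} (ξ : Fin n → ℂ) (ν : Fin n → ℤ) : ℂ :=
  (∏ i, p.latPow (ξ i) (ν i) p.α *
      ((qPochInf p.q (p.q * p.a₁⁻¹ * p.pt ξ ν i) * qPochInf p.q (p.q * p.a₂⁻¹ * p.pt ξ ν i)) /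
        (qPochInf p.q (p.b₁ * p.pt ξ ν i) * qPochInf p.q (p.b₂ * p.pt ξ ν i)))) *
    ∏ j, ∏ k ∈ Finset.Ioi j, p.latPow (ξ j) (ν j) (2 * p.τ - 1) *
      (qPochInf p.q (p.q * p.t⁻¹ * (p.pt ξ ν k / p.pt ξ ν j)) /
        qPochInf p.q (p.t * (p.pt ξ ν k / p.pt ξ ν j)))

/-- The summand `φ(z) Φ(z) Δ(z)`, at the lattice point `z` with index `ν`. -/
def integrand (p : SelbergParams) {n : ℕ} (φ : (Fin n → ℂ) → ℂ) (ξ : Fin n → ℂ)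
    (ν : Fin n → ℤ) : ℂ :=
  φ (p.pt ξ ν) * p.Phi ξ ν * vdm (p.pt ξ ν)

/-- The Jackson integral of symmetric Selberg type `⟨φ, ξ⟩`. -/
def jackson (p : SelbergParams) {n : ℕ} (φ : (Fin n → ℂ) → ℂ) (ξ : Fin n → ℂ) : ℂ :=
  (1 - p.q) ^ n * ∑' ν : Fin n → ℤ, p.integrand φ ξ ν

/-- The base points: points `ξ` with non-zero coordinates for which no denominator of `Φ` vanishes
on the lattice through `ξ`. -/
def Admissible (p : SelbergParams) {n : ℕ} (ξ : Fin n → ℂ) : Prop :=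
  (∀ i, ξ i ≠ 0) ∧
  (∀ i, ∀ m : ℤ, p.b₁ * ξ i * p.q ^ m ≠ 1 ∧ p.b₂ * ξ i * p.q ^ m ≠ 1) ∧
  ∀ j k, j < k → ∀ m : ℤ, p.t * (ξ k / ξ j) * p.q ^ m ≠ 1

/-- The row vector `(⟨e_0(a₁, b₂), ξ⟩, …, ⟨e_n(a₁, b₂), ξ⟩)`. -/
def row (p : SelbergParams) (n : ℕ) (ξ : Fin n → ℂ) : Fin (n + 1) → ℂ :=
  fun i => p.jackson (matsuo p.t p.a₁ p.b₂ (i : ℕ)) ξ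

/-- `A` is a coefficient matrix of the `q`-difference system for the shift `α ↦ α + 1`: for every
base point `ξ` the Jackson integrals involved converge, before and after the shift, and
`T_α (⟨e_0, ξ⟩, …, ⟨e_n, ξ⟩) = (⟨e_0, ξ⟩, …, ⟨e_n, ξ⟩) A`. The matrix does not depend on `ξ`. -/
def IsShiftMatrix (p : SelbergParams) (n : ℕ) (A : Matrix (Fin (n + 1)) (Fin (n + 1)) ℂ) : Prop :=
  ∀ ξ : Fin n → ℂ, p.Admissible ξ →
    (∀ i : Fin (n + 1),
      Summable (p.integrand (matsuo p.t p.a₁ p.b₂ (i : ℕ)) ξ) ∧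
      Summable (p.shift.integrand (matsuo p.t p.a₁ p.b₂ (i : ℕ)) ξ)) ∧
    p.shift.row n ξ = Matrix.vecMul (p.row n ξ) A

/-- The entries of the lower triangular factor `L_A`. -/
def lA (p : SelbergParams) (n i j : ℕ) : ℂ :=
  if j ≤ i then
    (-1) ^ (i - j) * p.t ^ (((n - i).choose 2 : ℤ) - ((n - j).choose 2 : ℤ)) *
      qBinom p.t (n - j) (n - i) *
      (qPoch p.t (p.a₂ * p.b₂ * p.t ^ j) (i - j) /
        qPoch p.t (p.qα * p.a₂ * p.b₂ * p.t ^ (2 * j)) (i - j))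
  else 0

/-- The diagonal entries of `D_A`. -/
def dA (p : SelbergParams) (n j : ℕ) : ℂ :=
  p.a₁ ^ (n - j) * p.a₂ ^ j * p.t ^ (j.choose 2 + (n - j).choose 2) *
    ((qPoch p.t p.qα j * qPoch p.t (p.qα * p.a₂ * p.b₂ * p.t ^ (2 * j)) (n - j)) /
      (qPoch p.t (p.qα * p.a₂ * p.b₂ * p.t ^ ((j : ℤ) - 1)) j *
        qPoch p.t (p.qα * p.a₁ * p.a₂ * p.b₁ * p.b₂ * p.t ^ ((n : ℤ) + j - 1)) (n - j)))

/-- The entries of the upper triangular factor `U_A`. -/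
def uA (p : SelbergParams) (n i j : ℕ) : ℂ :=
  if i ≤ j then
    (-(p.qα * p.a₁⁻¹ * p.a₂)) ^ (j - i) * p.t ^ ((j.choose 2 : ℤ) - (i.choose 2 : ℤ)) *
      qBinom p.t j i *
      (qPoch p.t (p.a₁ * p.b₁ * p.t ^ (n - j)) (j - i) /
        qPoch p.t (p.qα * p.a₂ * p.b₂ * p.t ^ (2 * i)) (j - i))
  else 0

/-- The lower unitriangular matrix `L_A`, with rows and columns indexed by `0, …, n`. -/
def matL (p : SelbergParams) (n : ℕ) : Matrix (Fin (n + 1)) (Fin (n + 1)) ℂ :=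
  Matrix.of fun i j => p.lA n i j

/-- The diagonal matrix `D_A`. -/
def matD (p : SelbergParams) (n : ℕ) : Matrix (Fin (n + 1)) (Fin (n + 1)) ℂ :=
  Matrix.diagonal fun j => p.dA n j

/-- The upper unitriangular matrix `U_A`. -/
def matU (p : SelbergParams) (n : ℕ) : Matrix (Fin (n + 1)) (Fin (n + 1)) ℂ :=
  Matrix.of fun i j => p.uA n i j

end SelbergParams

end

/-! The proof is algebra on words. Attach to each position `i` a one-variable letter `L_i`, multiply
the values `L_i(z_i)` by `∏_{k<l} (z_k - t⁻¹ z_l)`, skew-symmetrize and sum against `Φ` over the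
lattice; the result is multilinear in the letters.

Two mechanisms relate such sums. First, a factor `z` standing at one of two adjacent positions whose
letters otherwise agree moves to the left one at the price `t⁻¹` (`skewSymm_wordKernel_move`),
because the difference of the two kernels is symmetric in these two variables. Second, the lattice
is invariant under `z_i ↦ q z_i`, and `Φ` changes by a rational factor (`Phi_add_single`). Hence a
last letter `(1 - z/a₁)(1 - z/a₂)` may be replaced by a first letter `(1 - b₁ z)(1 - b₂ z)` at the
price `q^α t^(n-1)` (`skewSum_wordKernel_rotate`).

These are applied to the words `interp ξ k j`, with a factor `z` in the first `k` letters and `1 -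
z/a₁` in the last `j`. The row `k = 0` is `⟨e_j, ξ⟩` up to `(1 - q)^n`. Since `T_α` multiplies `Φ`
by `z_1 ⋯ z_n`, the row `k = n` is the shifted vector up to the same factor. Between them lies the
antidiagonal `k + j = n`. Below it the recurrence `interp_lower` leads down to `k = 0`; above it
`interp_upper` leads down to the antidiagonal. Both are solved in closed form by the two Pascal
rules for Gaussian binomials. The first solution is `L_A` times one diagonal factor
(`interp_middle_eq`), the second is another diagonal factor times `U_A` (`interp_top_eq`), and the
two diagonal factors multiply to `D_A`.

Absolute convergence, which permits the rearrangements, comes from two-sided geometric bounds on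
`Φ`; the four convergence inequalities are the extreme cases needed there. -/

noncomputable section

/-! ### Infinite `q`-products and their growth along a `q`-lattice -/

section qPochhammer

theorem qPoch_succ (c x : ℂ) (k : ℕ) : qPoch c x (k + 1) = qPoch c x k * (1 - c ^ k * x) :=
  Finset.prod_range_succ _ _

theorem qPoch_succ' (c x : ℂ) (k : ℕ) : qPoch c x (k + 1) = (1 - x) * qPoch c (x * c) k := by
  unfold qPoch
  rw [Finset.prod_range_succ', mul_comm]
  congr 1
  · simp
  · exact Finset.prod_congr rfl fun i _ => by ring

@[simp] theorem qPoch_zero (c x : ℂ) : qPoch c x 0 = 1 := rfl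

variable {q : ℂ}

theorem summable_norm_neg_pow_mul (hq : ‖q‖ < 1) (x : ℂ) : Summable fun i : ℕ => ‖-(q ^ i * x)‖ := by
  simp only [norm_neg, norm_mul, norm_pow]
  exact (summable_geometric_of_lt_one (norm_nonneg _) hq).mul_right _

theorem multipliable_one_sub_pow_mul (hq : ‖q‖ < 1) (x : ℂ) :
    Multipliable fun i : ℕ => 1 - q ^ i * x := by
  simpa only [sub_eq_add_neg] using
    multipliable_one_add_of_summable (summable_norm_neg_pow_mul hq x)

theorem tendsto_qPoch (hq : ‖q‖ < 1) (x : ℂ) :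
    Filter.Tendsto (qPoch q x) Filter.atTop (nhds (qPochInf q x)) :=
  (multipliable_one_sub_pow_mul hq x).tendsto_prod_tprod_nat

theorem qPochInf_step (hq : ‖q‖ < 1) (x : ℂ) :
    qPochInf q x = (1 - x) * qPochInf q (q * x) := by
  refine tendsto_nhds_unique ((tendsto_qPoch hq x).comp (Filter.tendsto_add_atTop_nat 1)) ?_
  refine ((tendsto_qPoch hq (q * x)).const_mul (1 - x)).congr fun k => ?_
  simp [qPoch_succ', mul_comm x q]

theorem qPochInf_eq_qPoch_mul (hq : ‖q‖ < 1) (x : ℂ) (k : ℕ) :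
    qPochInf q x = qPoch q x k * qPochInf q (q ^ k * x) := by
  induction k with
  | zero => simp
  | succ k ih => rw [ih, qPoch_succ, qPochInf_step hq (q ^ k * x)]; ring_nf

theorem qPochInf_ne_zero (hq : ‖q‖ < 1) {x : ℂ} (hx : ∀ i : ℕ, q ^ i * x ≠ 1) :
    qPochInf q x ≠ 0 := by
  unfold qPochInf
  simp only [sub_eq_add_neg]
  refine tprod_one_add_ne_zero_of_summable (fun i h => hx i ?_) (summable_norm_neg_pow_mul hq x)
  linear_combination -h

theorem norm_qPoch_le (hq : ‖q‖ < 1) (x : ℂ) (k : ℕ) :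
    ‖qPoch q x k‖ ≤ Real.exp (‖x‖ / (1 - ‖q‖)) := by
  have h1 := Finset.norm_prod_one_add_sub_one_le (Finset.range k) fun i => -(q ^ i * x)
  simp only [← sub_eq_add_neg] at h1
  have h2 : ∑ i ∈ Finset.range k, ‖-(q ^ i * x)‖ ≤ ‖x‖ / (1 - ‖q‖) := by
    refine ((summable_norm_neg_pow_mul hq x).sum_le_tsum _ fun i _ => norm_nonneg _).trans
      (le_of_eq ?_)
    simp only [norm_neg, norm_mul, norm_pow]
    rw [tsum_mul_right, tsum_geometric_of_lt_one (norm_nonneg _) hq, div_eq_inv_mul]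
  have h3 := Real.exp_le_exp.2 h2
  have h4 : ‖qPoch q x k‖ ≤ ‖qPoch q x k - 1‖ + 1 := by
    simpa using norm_add_le (qPoch q x k - 1) 1
  unfold qPoch at *
  linarith

theorem norm_qPochInf_le (hq : ‖q‖ < 1) (x : ℂ) :
    ‖qPochInf q x‖ ≤ Real.exp (‖x‖ / (1 - ‖q‖)) :=
  le_of_tendsto (tendsto_qPoch hq x).norm (Filter.Eventually.of_forall (norm_qPoch_le hq x))

theorem exists_norm_inv_qPoch_le (hq : ‖q‖ < 1) {x : ℂ} (hx : ∀ i : ℕ, q ^ i * x ≠ 1) :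
    ∃ C : ℝ, ∀ k, ‖(qPoch q x k)⁻¹‖ ≤ C := by
  have h := ((tendsto_qPoch hq x).inv₀ (qPochInf_ne_zero hq hx)).norm
  obtain ⟨C, hC⟩ := h.bddAbove_range
  exact ⟨C, fun k => hC ⟨k, rfl⟩⟩

/-- Shifting the argument of the infinite product against the direction of convergence. -/
theorem qPochInf_div_pow (hq0 : q ≠ 0) (hq : ‖q‖ < 1) {c : ℂ} (hc : c ≠ 0) (k : ℕ) :
    qPochInf q (c / q ^ k) =
      (∏ i ∈ Finset.range k, (-c / q ^ (i + 1))) * qPoch q (q / c) k * qPochInf q c := by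
  induction k with
  | zero => simp
  | succ k ih =>
    rw [qPochInf_step hq, Finset.prod_range_succ, qPoch_succ]
    have h1 : q * (c / q ^ (k + 1)) = c / q ^ k := by field_simp; ring
    have h2 : 1 - c / q ^ (k + 1) = (-c / q ^ (k + 1)) * (1 - q ^ k * (q / c)) := by
      field_simp; ring
    rw [h1, ih, h2]; ring

/-- Growth of a quotient of infinite products along a `q`-lattice. -/
theorem exists_norm_qPochInf_div_le (hq0 : q ≠ 0) (hq : ‖q‖ < 1) {c d : ℂ} (hc : c ≠ 0)
    (hd : d ≠ 0) (h : ∀ m : ℤ, d * q ^ m ≠ 1) :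
    ∃ C : ℝ, 0 ≤ C ∧ ∀ m : ℤ, ‖qPochInf q (c * q ^ m) / qPochInf q (d * q ^ m)‖ ≤
      C * (if 0 ≤ m then 1 else ‖d / c‖ ^ m) := by
  have hd0 : qPochInf q d ≠ 0 := qPochInf_ne_zero hq fun i => by
    simpa [mul_comm] using h i
  -- A zero of `(q/d; q)_k` would mean `d q^m = 1` for some negative `m`, which `h` excludes.
  obtain ⟨C₂, hC₂⟩ := exists_norm_inv_qPoch_le hq (x := q / d) fun i hi => by
    apply h (-(i + 1 : ℕ))
    rw [zpow_neg, zpow_natCast, pow_succ]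
    field_simp at hi ⊢
    rw [← hi]
  have hC₂0 : 0 ≤ C₂ := (norm_nonneg _).trans (hC₂ 0)
  set ρ := 1 - ‖q‖ with hρ
  have hρ0 : 0 < ρ := by simp [hρ, hq]
  -- `M₁` serves `m ≥ 0`, where numerator and inverse denominator are bounded separately. `M₂`
  -- serves `m < 0`, where `qPochInf_div_pow` is applied above and below: the Gaussian powers of `q`
  -- cancel and only `(c/d)^k` survives.
  let M₁ := Real.exp (‖c‖ / ρ) * (Real.exp (‖d‖ / ρ) * ‖(qPochInf q d)⁻¹‖)
  let M₂ := Real.exp (‖q / c‖ / ρ) * C₂ * ‖qPochInf q c / qPochInf q d‖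
  have hM₁ : 0 ≤ M₁ := by positivity
  have hM₂ : 0 ≤ M₂ := by positivity
  refine ⟨M₁ + M₂, by positivity, fun m => ?_⟩
  split_ifs with hm
  · obtain ⟨k, rfl⟩ := Int.eq_ofNat_of_zero_le hm
    rw [mul_one]
    refine le_trans ?_ (le_add_of_nonneg_right hM₂)
    rw [div_eq_mul_inv, norm_mul, zpow_natCast]
    refine mul_le_mul ?_ ?_ (norm_nonneg _) (by positivity)
    · refine (norm_qPochInf_le hq _).trans (Real.exp_le_exp.2 ?_)
      rw [norm_mul, norm_pow]
      gcongr
      exact mul_le_of_le_one_right (norm_nonneg _) (pow_le_one₀ (norm_nonneg _) hq.le)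
    · have h1 := qPochInf_eq_qPoch_mul hq d k
      have h2 : (qPochInf q (d * q ^ k))⁻¹ = qPoch q d k * (qPochInf q d)⁻¹ := by
        rw [mul_comm d]
        have h3 : qPochInf q (q ^ k * d) ≠ 0 := fun h0 => hd0 (by rw [h1, h0, mul_zero])
        field_simp
        rw [h1, mul_comm]
      rw [h2, norm_mul]
      gcongr
      exact norm_qPoch_le hq d k
  · obtain ⟨k, hk⟩ := Int.eq_ofNat_of_zero_le (a := -m) (by omega)
    obtain rfl : m = -(k : ℤ) := by omega
    refine le_trans ?_ (mul_le_mul_of_nonneg_right (le_add_of_nonneg_left hM₁) (by positivity))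
    have e : ∀ x : ℂ, x * q ^ (-(k : ℤ)) = x / q ^ k := fun x => by
      rw [zpow_neg, zpow_natCast, div_eq_mul_inv]
    rw [e, e, qPochInf_div_pow hq0 hq hc, qPochInf_div_pow hq0 hq hd]
    have h1 : (∏ i ∈ Finset.range k, (-c / q ^ (i + 1))) =
        (∏ i ∈ Finset.range k, (-d / q ^ (i + 1))) * (c / d) ^ k := by
      rw [← Finset.card_range k, ← Finset.prod_const, Finset.card_range,
        ← Finset.prod_mul_distrib]
      exact Finset.prod_congr rfl fun i _ => by field_simp
    have h2 : (∏ i ∈ Finset.range k, (-d / q ^ (i + 1))) ≠ 0 :=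
      Finset.prod_ne_zero_iff.2 fun i _ => div_ne_zero (neg_ne_zero.2 hd) (pow_ne_zero _ hq0)
    have h3 : ((∏ i ∈ Finset.range k, (-c / q ^ (i + 1))) * qPoch q (q / c) k * qPochInf q c) /
        ((∏ i ∈ Finset.range k, (-d / q ^ (i + 1))) * qPoch q (q / d) k * qPochInf q d) =
        (qPoch q (q / c) k * (qPoch q (q / d) k)⁻¹ * (qPochInf q c / qPochInf q d)) *
          (c / d) ^ k := by
      rw [h1]
      generalize (∏ i ∈ Finset.range k, (-d / q ^ (i + 1))) = D at h2
      field_simp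
    rw [h3, norm_mul, norm_mul, norm_mul, norm_pow, zpow_neg, zpow_natCast, ← inv_pow,
      ← norm_inv, inv_div]
    refine mul_le_mul_of_nonneg_right ?_ (by positivity)
    refine mul_le_mul_of_nonneg_right ?_ (norm_nonneg _)
    exact mul_le_mul (norm_qPoch_le hq _ k) (hC₂ k) (norm_nonneg _) (Real.exp_nonneg _)

end qPochhammer

/-! ### Summability of geometric weights over `ℤ^n` -/

section Summability

theorem prod_Ioi_eq_prod_filter {M : Type*} [CommMonoid M] {n : ℕ} (f : Fin n → Fin n → M) :
    ∏ j, ∏ k ∈ Finset.Ioi j, f j k =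
      ∏ x ∈ Finset.univ.filter (fun x : Fin n × Fin n => x.1 < x.2), f x.1 x.2 := by
  rw [Finset.prod_filter, ← Finset.univ_product_univ, Finset.prod_product]
  refine Finset.prod_congr rfl fun j _ => ?_
  rw [← Finset.prod_filter, Finset.filter_lt_eq_Ioi]

theorem summable_prod_pi {ι : Type*} {n : ℕ} {g : Fin n → ι → ℝ} (hg0 : ∀ i m, 0 ≤ g i m)
    (hg : ∀ i, Summable (g i)) : Summable fun ν : Fin n → ι => ∏ i, g i (ν i) := by
  induction n with
  | zero => exact Summable.of_finite
  | succ n ih =>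
    rw [← (Fin.consEquiv fun _ => ι).summable_iff]
    have := (hg 0).mul_of_nonneg (ih (fun i m => hg0 i.succ m) fun i => hg i.succ) (hg0 0)
      fun ν => Finset.prod_nonneg fun i _ => hg0 _ _
    refine this.congr fun x => ?_
    simp [Fin.prod_univ_succ, Fin.consEquiv]

/-- A two-sided geometric weight. -/
def geomWeight (A B : ℝ) (m : ℤ) : ℝ := if 0 ≤ m then A ^ m else B ^ m

theorem geomWeight_nonneg {A B : ℝ} (hA : 0 < A) (hB : 0 < B) (m : ℤ) : 0 ≤ geomWeight A B m := by
  unfold geomWeight; split_ifs <;> positivity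

variable {A B T : ℝ}

theorem summable_geomWeight_mul (hA : 0 < A) (hB : 0 < B) (hT : 0 < T) {s : ℕ}
    (hA1 : A * T ^ s < 1) (hB1 : 1 < B * T ^ s) :
    Summable fun m : ℤ => geomWeight A B m * (T ^ m) ^ s := by
  refine Summable.of_nat_of_neg ?_ ?_
  · refine (summable_geometric_of_lt_one (by positivity) hA1).congr fun k => ?_
    simp [geomWeight, mul_pow, ← pow_mul, mul_comm]
  · refine (summable_geometric_of_lt_one (by positivity) (inv_lt_one_of_one_lt₀ hB1)).congr
      fun k => ?_
    have : geomWeight A B (-k) = (B ^ k)⁻¹ := by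
      unfold geomWeight
      split_ifs with h
      · obtain rfl : k = 0 := by omega
        simp
      · simp
    rw [this, mul_inv, mul_pow, inv_pow, inv_pow, zpow_neg, zpow_natCast, inv_pow, ← pow_mul,
      ← pow_mul, mul_comm s]

/-- `T` may lie on either side of `1`, so the worst exponent is `0` or `N`; controlling these two
extremes suffices. -/
theorem mul_pow_lt_one_of_le (hA : 0 < A) (hT : 0 < T) {N s : ℕ} (hs : s ≤ N) (h0 : A < 1)
    (h1 : A * T ^ N < 1) : A * T ^ s < 1 := by
  rcases le_total T 1 with h | h
  · exact (mul_le_of_le_one_right hA.le (pow_le_one₀ hT.le h)).trans_lt h0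
  · exact (mul_le_mul_of_nonneg_left (pow_le_pow_right₀ h hs) hA.le).trans_lt h1

theorem one_lt_mul_pow_of_le (hB : 0 < B) (hT : 0 < T) {N s : ℕ} (hs : s ≤ N) (h0 : 1 < B)
    (h1 : 1 < B * T ^ N) : 1 < B * T ^ s := by
  rcases le_total T 1 with h | h
  · exact h1.trans_le (mul_le_mul_of_nonneg_left (pow_le_pow_of_le_one hT.le h hs) hB.le)
  · exact h0.trans_le (le_mul_of_one_le_right hB.le (one_le_pow₀ h))

/-- Induction on the set of pairs: the factor of one pair splits the series in two, each raising one
exponent `s i` by one. The hypothesis `hs` is stable under this trade, and with no pairs left the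
series is a product of one-variable geometric series. -/
theorem summable_geomWeight_mul_prod_pairs (hA : 0 < A) (hB : 0 < B) (hT : 0 < T) {N : ℕ}
    (hA0 : A < 1) (hA1 : A * T ^ N < 1) (hB0 : 1 < B) (hB1 : 1 < B * T ^ N) {n : ℕ}
    (P : Finset (Fin n × Fin n)) (s : Fin n → ℕ)
    (hs : ∀ i, s i + (P.filter fun x => x.1 = i ∨ x.2 = i).card ≤ N) :
    Summable fun ν : Fin n → ℤ => (∏ i, geomWeight A B (ν i) * (T ^ ν i) ^ s i) *
      ∏ x ∈ P, (T ^ ν x.1 + T ^ ν x.2) := by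
  induction P using Finset.induction_on generalizing s with
  | empty =>
    simp only [Finset.prod_empty, mul_one]
    refine summable_prod_pi (g := fun i m => geomWeight A B m * (T ^ m) ^ s i)
      (fun i m => mul_nonneg (geomWeight_nonneg hA hB m) (by positivity)) fun i => ?_
    have hi : s i ≤ N := by simpa using hs i
    exact summable_geomWeight_mul hA hB hT (mul_pow_lt_one_of_le hA hT hi hA0 hA1)
      (one_lt_mul_pow_of_le hB hT hi hB0 hB1)
  | insert x P hx ih =>
    have key : ∀ y : Fin n, (y = x.1 ∨ y = x.2) → Summable fun ν : Fin n → ℤ =>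
        ((∏ i, geomWeight A B (ν i) * (T ^ ν i) ^ s i) * T ^ ν y) *
          ∏ x ∈ P, (T ^ ν x.1 + T ^ ν x.2) := fun y hy => by
      refine (ih (fun i => s i + if i = y then 1 else 0) fun i => ?_).congr fun ν => ?_
      · refine le_trans ?_ (hs i)
        by_cases hi : i = y
        · have hy' : x.1 = i ∨ x.2 = i := by rw [hi]; exact hy.imp Eq.symm Eq.symm
          rw [Finset.filter_insert, if_pos hi, if_pos hy',
            Finset.card_insert_of_notMem (by simp [hx])]
          omega
        · rw [if_neg hi, add_zero]
          gcongr
          exact Finset.subset_insert _ _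
      · congr 1
        simp only [pow_add, ← mul_assoc, Finset.prod_mul_distrib, pow_ite, pow_one, pow_zero]
        rw [Finset.prod_ite_eq' Finset.univ y]
        simp
    refine ((key x.1 (Or.inl rfl)).add (key x.2 (Or.inr rfl))).congr fun ν => ?_
    rw [Finset.prod_insert hx]
    ring

theorem card_filter_pairs_le {n : ℕ} (i : Fin n) :
    ((Finset.univ.filter fun x : Fin n × Fin n => x.1 < x.2).filter
      fun x => x.1 = i ∨ x.2 = i).card ≤ n - 1 := by
  have h : (Finset.univ.erase i).card = n - 1 := by
    rw [Finset.card_erase_of_mem (Finset.mem_univ i), Finset.card_univ, Fintype.card_fin]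
  rw [← h]
  -- A pair through `i` is determined by its other element.
  refine Finset.card_le_card_of_injOn (fun x => if x.1 = i then x.2 else x.1) ?_ ?_
  · rintro ⟨j, k⟩ hx
    simp only [Finset.coe_filter, Finset.mem_filter, Finset.mem_univ, true_and,
      Set.mem_ofPred_eq] at hx
    have := hx.1.ne
    simp only [Finset.coe_erase, Finset.coe_univ, Set.mem_sdiff, Set.mem_univ, true_and,
      Set.mem_singleton_iff]
    split_ifs with hj
    · exact fun hk => this (hj.trans hk.symm)
    · exact hj
  · rintro ⟨j, k⟩ hx ⟨j', k'⟩ hx' hxx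
    simp only [Finset.coe_filter, Finset.mem_filter, Finset.mem_univ, true_and,
      Set.mem_ofPred_eq] at hx hx' hxx
    simp only [Prod.mk.injEq]
    grind

theorem summable_geomWeight_prod_Ioi (hA : 0 < A) (hB : 0 < B) (hT : 0 < T) {n : ℕ}
    (hA0 : A < 1) (hA1 : A * T ^ (n - 1) < 1) (hB0 : 1 < B) (hB1 : 1 < B * T ^ (n - 1)) :
    Summable fun ν : Fin n → ℤ => (∏ i, geomWeight A B (ν i)) *
      ∏ j, ∏ k ∈ Finset.Ioi j, (T ^ ν j + T ^ ν k) := by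
  simp only [prod_Ioi_eq_prod_filter]
  simpa using summable_geomWeight_mul_prod_pairs hA hB hT hA0 hA1 hB0 hB1 _ (fun _ => 0)
    fun i => by simpa using card_filter_pairs_le i

end Summability

/-- Functions that grow at most like `∏ (1 + |z_i|²) ∏_{j<k} (|z_j| + |z_k|)`. -/
def Tame {n : ℕ} (f : (Fin n → ℂ) → ℂ) : Prop :=
  ∃ C : ℝ, 0 ≤ C ∧ ∀ z, ‖f z‖ ≤
    C * ((∏ i, (1 + ‖z i‖ ^ 2)) * ∏ j, ∏ k ∈ Finset.Ioi j, (‖z j‖ + ‖z k‖))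

/-- Matches each growth factor of a tame function with the corresponding factor of `Φ`, so that the
bounds on `Φ` can be applied factor by factor. -/
theorem prod_mul_prod_Ioi_le {n : ℕ} {a b c w : Fin n → ℝ} {a' b' c' w' : Fin n → Fin n → ℝ}
    (h0 : ∀ i, 0 ≤ b i * a i) (h0' : ∀ j k, 0 ≤ b' j k * a' j k) (h1 : ∀ i, 0 ≤ c i * w i)
    (h : ∀ i, b i * a i ≤ c i * w i) (h' : ∀ j k, j < k → b' j k * a' j k ≤ c' j k * w' j k) :
    ((∏ i, a i) * ∏ j, ∏ k ∈ Finset.Ioi j, a' j k) *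
        ((∏ i, b i) * ∏ j, ∏ k ∈ Finset.Ioi j, b' j k) ≤
      ((∏ i, c i) * ∏ j, ∏ k ∈ Finset.Ioi j, c' j k) *
        ((∏ i, w i) * ∏ j, ∏ k ∈ Finset.Ioi j, w' j k) := by
  rw [mul_mul_mul_comm, mul_comm (∏ i, a i), mul_comm (∏ j, ∏ k ∈ Finset.Ioi j, a' j k),
    mul_mul_mul_comm (∏ i, c i)]
  refine mul_le_mul ?_ ?_ ?_ ?_
  · simp only [← Finset.prod_mul_distrib]
    exact Finset.prod_le_prod (fun i _ => h0 i) fun i _ => h i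
  · simp only [← Finset.prod_mul_distrib]
    exact Finset.prod_le_prod (fun j _ => Finset.prod_nonneg fun k _ => h0' j k) fun j _ =>
      Finset.prod_le_prod (fun k _ => h0' j k) fun k hk => h' j k (Finset.mem_Ioi.1 hk)
  · simp only [← Finset.prod_mul_distrib]
    exact Finset.prod_nonneg fun j _ => Finset.prod_nonneg fun k _ => h0' j k
  · simp only [← Finset.prod_mul_distrib]
    exact Finset.prod_nonneg fun i _ => h1 i

/-! ### Bounds for `Φ` and absolute convergence -/

namespace SelbergParams

theorem t_ne_zero {p : SelbergParams} (hq0 : p.q ≠ 0) : p.t ≠ 0 := by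
  simp [t, Complex.cpow_eq_zero_iff, hq0]

theorem qα_ne_zero {p : SelbergParams} (hq0 : p.q ≠ 0) : p.qα ≠ 0 := by
  simp [qα, Complex.cpow_eq_zero_iff, hq0]

theorem cpow_two_mul_τ_sub_one {p : SelbergParams} (hq0 : p.q ≠ 0) :
    p.q ^ (2 * p.τ - 1) = p.t ^ 2 / p.q := by
  rw [Complex.cpow_sub _ _ hq0, Complex.cpow_one, two_mul, Complex.cpow_add _ _ hq0, sq, t]

theorem shift_qα {p : SelbergParams} (hq0 : p.q ≠ 0) : p.shift.qα = p.qα * p.q := by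
  simp [shift, qα, Complex.cpow_add _ _ hq0]

@[simp] theorem shift_t (p : SelbergParams) : p.shift.t = p.t := rfl

theorem norm_pt (p : SelbergParams) {n : ℕ} (ξ : Fin n → ℂ) (ν : Fin n → ℤ) (i : Fin n) :
    ‖p.pt ξ ν i‖ = ‖ξ i‖ * ‖p.q‖ ^ ν i := by simp [pt]

/-- The one-variable factors of `Φ`, at the point `x q ^ m`. -/
def PhiOne (p : SelbergParams) (x : ℂ) (m : ℤ) : ℂ :=
  p.latPow x m p.α *
    ((qPochInf p.q (p.q * p.a₁⁻¹ * (x * p.q ^ m)) * qPochInf p.q (p.q * p.a₂⁻¹ * (x * p.q ^ m))) /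
      (qPochInf p.q (p.b₁ * (x * p.q ^ m)) * qPochInf p.q (p.b₂ * (x * p.q ^ m))))

/-- The two-variable factors of `Φ`, at the points `x q ^ m` and `y q ^ l`. -/
def PhiTwo (p : SelbergParams) (x y : ℂ) (m l : ℤ) : ℂ :=
  p.latPow x m (2 * p.τ - 1) *
    (qPochInf p.q (p.q * p.t⁻¹ * (y * p.q ^ l / (x * p.q ^ m))) /
      qPochInf p.q (p.t * (y * p.q ^ l / (x * p.q ^ m))))

theorem Phi_eq (p : SelbergParams) {n : ℕ} (ξ : Fin n → ℂ) (ν : Fin n → ℤ) :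
    p.Phi ξ ν = (∏ i, p.PhiOne (ξ i) (ν i)) *
      ∏ j, ∏ k ∈ Finset.Ioi j, p.PhiTwo (ξ j) (ξ k) (ν j) (ν k) := rfl

variable {p : SelbergParams}

/-- For `m ≥ 0` everything but `z^α` is bounded. For `m < 0` the two quotients contribute `|a₁ b₁ /
q|^m` and `|a₂ b₂ / q|^m`, and the quadratic weight contributes `|q|^(2m)`; the powers of `q`
cancel. Quadratic growth is allowed because the letters have degree up to two. -/
theorem exists_norm_PhiOne_le (hq0 : p.q ≠ 0) (hq1 : ‖p.q‖ < 1)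
    (ha₁ : p.a₁ ≠ 0) (ha₂ : p.a₂ ≠ 0) (hb₁ : p.b₁ ≠ 0) (hb₂ : p.b₂ ≠ 0) {x : ℂ} (hx : x ≠ 0)
    (h : ∀ m : ℤ, p.b₁ * x * p.q ^ m ≠ 1 ∧ p.b₂ * x * p.q ^ m ≠ 1) :
    ∃ C : ℝ, 0 ≤ C ∧ ∀ m : ℤ, ‖p.PhiOne x m‖ * (1 + (‖x‖ * ‖p.q‖ ^ m) ^ 2) ≤
      C * geomWeight ‖p.qα‖ ‖p.qα * p.a₁ * p.a₂ * p.b₁ * p.b₂‖ m := by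
  obtain ⟨C₁, h₁, hC₁⟩ := exists_norm_qPochInf_div_le hq0 hq1 (c := p.q * p.a₁⁻¹ * x)
    (d := p.b₁ * x) (by positivity) (by positivity) fun m => (h m).1
  obtain ⟨C₂, h₂, hC₂⟩ := exists_norm_qPochInf_div_le hq0 hq1 (c := p.q * p.a₂⁻¹ * x)
    (d := p.b₂ * x) (by positivity) (by positivity) fun m => (h m).2
  refine ⟨‖x ^ p.α‖ * (C₁ * C₂) * (1 + ‖x‖ ^ 2), by positivity, fun m => ?_⟩
  have hρ : 0 < ‖p.q‖ := norm_pos_iff.2 hq0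
  have h1 : ‖p.PhiOne x m‖ ≤ ‖x ^ p.α‖ * ‖p.qα‖ ^ m *
      ((C₁ * (if 0 ≤ m then 1 else ‖p.b₁ * x / (p.q * p.a₁⁻¹ * x)‖ ^ m)) *
        (C₂ * (if 0 ≤ m then 1 else ‖p.b₂ * x / (p.q * p.a₂⁻¹ * x)‖ ^ m))) := by
    rw [PhiOne, mul_div_mul_comm, norm_mul, norm_mul, latPow, norm_mul, norm_zpow]
    simp only [← mul_assoc _ x]
    exact mul_le_mul_of_nonneg_left (mul_le_mul (hC₁ m) (hC₂ m) (norm_nonneg _) (by positivity))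
      (by positivity)
  refine (mul_le_mul_of_nonneg_right h1 (by positivity)).trans ?_
  unfold geomWeight
  split_ifs with hm
  · have h2 : ‖p.q‖ ^ m ≤ 1 := by
      obtain ⟨k, rfl⟩ := Int.eq_ofNat_of_zero_le hm
      simpa using pow_le_one₀ hρ.le hq1.le
    have h3 : 1 + (‖x‖ * ‖p.q‖ ^ m) ^ 2 ≤ 1 + ‖x‖ ^ 2 := by
      gcongr
      exact mul_le_of_le_one_right (norm_nonneg _) h2
    calc _ ≤ ‖x ^ p.α‖ * ‖p.qα‖ ^ m * (C₁ * 1 * (C₂ * 1)) * (1 + ‖x‖ ^ 2) := by gcongr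
      _ = _ := by ring
  · have h2 : 1 ≤ ‖p.q‖ ^ m := by
      obtain ⟨k, hk⟩ := Int.eq_ofNat_of_zero_le (a := -m) (by omega)
      rw [← neg_neg m, hk, zpow_neg, zpow_natCast]
      exact one_le_inv_iff₀.2 ⟨by positivity, pow_le_one₀ hρ.le hq1.le⟩
    have h3 : 1 + (‖x‖ * ‖p.q‖ ^ m) ^ 2 ≤ (1 + ‖x‖ ^ 2) * (‖p.q‖ ^ m) ^ 2 := by
      have : 1 ≤ (‖p.q‖ ^ m) ^ 2 := one_le_pow₀ h2
      nlinarith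
    have e : ‖p.qα * p.a₁ * p.a₂ * p.b₁ * p.b₂‖ = ‖p.qα‖ * ‖p.b₁ * x / (p.q * p.a₁⁻¹ * x)‖ *
        ‖p.b₂ * x / (p.q * p.a₂⁻¹ * x)‖ * ‖p.q‖ ^ 2 := by
      rw [← norm_pow, ← norm_mul, ← norm_mul, ← norm_mul]
      congr 1
      field_simp
    calc _ ≤ ‖x ^ p.α‖ * ‖p.qα‖ ^ m * (C₁ * ‖p.b₁ * x / (p.q * p.a₁⁻¹ * x)‖ ^ m *
          (C₂ * ‖p.b₂ * x / (p.q * p.a₂⁻¹ * x)‖ ^ m)) *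
          ((1 + ‖x‖ ^ 2) * (‖p.q‖ ^ m) ^ 2) := by gcongr
      _ = _ := by
        rw [e, mul_zpow, mul_zpow, mul_zpow, sq ‖p.q‖, mul_zpow]; ring

/-- The power `z_j^(2τ-1)` and, for `l < m`, the quotient of products both grow with ratio
`|t|²/|q|`. The weight `|z_j| + |z_k|` is governed by the smaller exponent, and its `|q|` turns this
ratio into `|t|²`. This leaves a bound symmetric in `m` and `l` up to the constant. -/
theorem exists_norm_PhiTwo_le (hq0 : p.q ≠ 0) (hq1 : ‖p.q‖ < 1) {x y : ℂ} (hx : x ≠ 0)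
    (hy : y ≠ 0) (h : ∀ m : ℤ, p.t * (y / x) * p.q ^ m ≠ 1) :
    ∃ C : ℝ, 0 ≤ C ∧ ∀ m l : ℤ, ‖p.PhiTwo x y m l‖ * (‖x‖ * ‖p.q‖ ^ m + ‖y‖ * ‖p.q‖ ^ l) ≤
      C * ((‖p.t‖ ^ 2) ^ m + (‖p.t‖ ^ 2) ^ l) := by
  have ht0 := t_ne_zero hq0
  obtain ⟨C, h₁, hC⟩ := exists_norm_qPochInf_div_le hq0 hq1 (c := p.q * p.t⁻¹ * (y / x))
    (d := p.t * (y / x)) (by positivity) (by positivity) h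
  have hρ : 0 < ‖p.q‖ := norm_pos_iff.2 hq0
  have htn : 0 < ‖p.t‖ := norm_pos_iff.2 ht0
  have mono : ∀ a b : ℤ, a ≤ b → ‖p.q‖ ^ b ≤ ‖p.q‖ ^ a := fun a b hab =>
    zpow_le_zpow_right_of_le_one₀ hρ hq1.le hab
  refine ⟨‖x ^ (2 * p.τ - 1)‖ * C * (‖x‖ + ‖y‖), by positivity, fun m l => ?_⟩
  have e1 : y * p.q ^ l / (x * p.q ^ m) = y / x * p.q ^ (l - m) := by
    rw [zpow_sub₀ hq0]; field_simp
  have e2 : ‖p.t * (y / x) / (p.q * p.t⁻¹ * (y / x))‖ = ‖p.t‖ ^ 2 / ‖p.q‖ := by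
    rw [← norm_pow, ← norm_div]
    congr 1
    field_simp
  have h1 : ‖p.PhiTwo x y m l‖ ≤ ‖x ^ (2 * p.τ - 1)‖ * (‖p.t‖ ^ 2 / ‖p.q‖) ^ m *
      (C * (if 0 ≤ l - m then 1 else (‖p.t‖ ^ 2 / ‖p.q‖) ^ (l - m))) := by
    rw [PhiTwo, e1, ← e2, norm_mul, latPow, norm_mul, norm_zpow, cpow_two_mul_τ_sub_one hq0, e2,
      norm_div, norm_pow, ← mul_assoc, ← mul_assoc p.t, ← e2]
    exact mul_le_mul_of_nonneg_left (hC (l - m)) (by positivity)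
  refine (mul_le_mul_of_nonneg_right h1 (by positivity)).trans ?_
  have hT : ∀ m : ℤ, (‖p.t‖ ^ 2) ^ m = (‖p.t‖ ^ 2 / ‖p.q‖) ^ m * ‖p.q‖ ^ m := fun m => by
    rw [← mul_zpow, div_mul_cancel₀ _ hρ.ne']
  split_ifs with hm
  · calc _ ≤ ‖x ^ (2 * p.τ - 1)‖ * (‖p.t‖ ^ 2 / ‖p.q‖) ^ m * (C * 1) *
          (‖x‖ * ‖p.q‖ ^ m + ‖y‖ * ‖p.q‖ ^ m) := by
          have := mono _ _ (sub_nonneg.1 hm)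
          gcongr
      _ = ‖x ^ (2 * p.τ - 1)‖ * C * (‖x‖ + ‖y‖) * (‖p.t‖ ^ 2) ^ m := by
          rw [hT]
          generalize ‖p.t‖ ^ 2 / ‖p.q‖ = D
          ring
      _ ≤ _ := by
          gcongr
          exact le_add_of_nonneg_right (by positivity)
  · calc _ ≤ ‖x ^ (2 * p.τ - 1)‖ * (‖p.t‖ ^ 2 / ‖p.q‖) ^ m *
          (C * (‖p.t‖ ^ 2 / ‖p.q‖) ^ (l - m)) * (‖x‖ * ‖p.q‖ ^ l + ‖y‖ * ‖p.q‖ ^ l) := by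
          have := mono l m (by omega)
          gcongr
      _ = ‖x ^ (2 * p.τ - 1)‖ * C * (‖x‖ + ‖y‖) * (‖p.t‖ ^ 2) ^ l := by
          have hD : ‖p.t‖ ^ 2 / ‖p.q‖ ≠ 0 := by positivity
          rw [hT, zpow_sub₀ hD]
          generalize ‖p.t‖ ^ 2 / ‖p.q‖ = D at hD ⊢
          field_simp
      _ ≤ _ := by
          gcongr
          exact le_add_of_nonneg_left (by positivity)

/-- The parameter conditions shared by the lemmas below. -/
structure Good (p : SelbergParams) (n : ℕ) : Prop where
  q_ne : p.q ≠ 0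
  q_lt : ‖p.q‖ < 1
  a₁_ne : p.a₁ ≠ 0
  a₂_ne : p.a₂ ≠ 0
  b₁_ne : p.b₁ ≠ 0
  b₂_ne : p.b₂ ≠ 0
  conv : p.Converges n
  conv' : p.shift.Converges n

variable {n : ℕ}

/-- This is the lower convergence bound at `α + 1`: the extra `q` there cancels the `q` on the other
side. The bound at `α` alone would not control letters of degree two. -/
theorem Good.one_lt (hp : p.Good n) : 1 < ‖p.qα * p.a₁ * p.a₂ * p.b₁ * p.b₂‖ := by
  have h := hp.conv'.1
  have := hp.q_ne; have := hp.a₁_ne; have := hp.a₂_ne; have := hp.b₁_ne; have := hp.b₂_ne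
  rw [shift_qα hp.q_ne] at h
  simp only [shift, norm_mul, norm_inv] at h ⊢
  have hq : 0 < ‖p.q‖ := by positivity
  have h1 : 0 < ‖p.a₁‖ := by positivity
  have h2 : 0 < ‖p.a₂‖ := by positivity
  have h3 : 0 < ‖p.b₁‖ := by positivity
  have h4 : 0 < ‖p.b₂‖ := by positivity
  field_simp at h
  linarith

theorem norm_t_zpow (hn : 1 ≤ n) :
    ‖p.t ^ (2 * (n : ℤ) - 2)‖ = (‖p.t‖ ^ 2) ^ (n - 1) := by
  have : (2 * (n : ℤ) - 2) = ((2 * (n - 1) : ℕ) : ℤ) := by push_cast [hn]; ring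
  rw [this, zpow_natCast, norm_pow, pow_mul]

theorem Good.one_lt_mul (hp : p.Good n) (hn : 1 ≤ n) :
    1 < ‖p.qα * p.a₁ * p.a₂ * p.b₁ * p.b₂‖ * (‖p.t‖ ^ 2) ^ (n - 1) := by
  have h := hp.conv'.2.2.1
  have := hp.q_ne; have := hp.a₁_ne; have := hp.a₂_ne; have := hp.b₁_ne; have := hp.b₂_ne
  rw [shift_qα hp.q_ne, norm_mul _ (_ ^ _), shift_t, norm_t_zpow hn] at h
  simp only [shift, norm_mul, norm_inv] at h ⊢
  have hq : 0 < ‖p.q‖ := by positivity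
  have h1 : 0 < ‖p.a₁‖ := by positivity
  have h2 : 0 < ‖p.a₂‖ := by positivity
  have h3 : 0 < ‖p.b₁‖ := by positivity
  have h4 : 0 < ‖p.b₂‖ := by positivity
  field_simp at h
  linarith

theorem summable_mul_Phi (hp : p.Good n) {ξ : Fin n → ℂ} (hξ : p.Admissible ξ)
    {f : (Fin n → ℂ) → ℂ} (hf : Tame f) : Summable fun ν => f (p.pt ξ ν) * p.Phi ξ ν := by
  have hq0 := hp.q_ne
  have ht0 := t_ne_zero hq0
  rcases Nat.eq_zero_or_pos n with rfl | hn
  · exact Summable.of_finite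
  obtain ⟨C, hC0, hC⟩ := hf
  choose C₁ hC₁0 hC₁ using fun i => exists_norm_PhiOne_le hq0 hp.q_lt hp.a₁_ne hp.a₂_ne hp.b₁_ne
    hp.b₂_ne (hξ.1 i) (hξ.2.1 i)
  have h2 : ∀ j k : Fin n, ∃ C : ℝ, 0 ≤ C ∧ (j < k → ∀ m l : ℤ,
      ‖p.PhiTwo (ξ j) (ξ k) m l‖ * (‖ξ j‖ * ‖p.q‖ ^ m + ‖ξ k‖ * ‖p.q‖ ^ l) ≤
      C * ((‖p.t‖ ^ 2) ^ m + (‖p.t‖ ^ 2) ^ l)) := fun j k => by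
    by_cases hjk : j < k
    · obtain ⟨C, h0, h⟩ := exists_norm_PhiTwo_le hq0 hp.q_lt (hξ.1 j) (hξ.1 k) (hξ.2.2 j k hjk)
      exact ⟨C, h0, fun _ => h⟩
    · exact ⟨0, le_rfl, fun h => absurd h hjk⟩
  choose C₂ hC₂0 hC₂ using h2
  have hB : 0 < ‖p.qα * p.a₁ * p.a₂ * p.b₁ * p.b₂‖ := zero_lt_one.trans hp.one_lt
  have hA : 0 < ‖p.qα‖ := norm_pos_iff.2 (qα_ne_zero hq0)
  have hT : 0 < ‖p.t‖ ^ 2 := by positivity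
  have hs := summable_geomWeight_prod_Ioi (n := n) hA hB hT hp.conv.2.1
    (by simpa only [norm_mul, norm_t_zpow hn] using hp.conv.2.2.2) hp.one_lt (hp.one_lt_mul hn)
  refine Summable.of_norm_bounded
    (hs.mul_left (C * ((∏ i, C₁ i) * ∏ j, ∏ k ∈ Finset.Ioi j, C₂ j k))) fun ν => ?_
  rw [norm_mul, Phi_eq, norm_mul, norm_prod, norm_prod]
  simp only [norm_prod]
  refine (mul_le_mul_of_nonneg_right (hC _) ?_).trans ?_
  · exact mul_nonneg (Finset.prod_nonneg fun i _ => norm_nonneg _)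
      (Finset.prod_nonneg fun i _ => Finset.prod_nonneg fun j _ => norm_nonneg _)
  rw [mul_assoc C, mul_assoc C]
  refine mul_le_mul_of_nonneg_left ?_ hC0
  simp only [norm_pt]
  exact prod_mul_prod_Ioi_le (fun i => mul_nonneg (norm_nonneg _) (by positivity))
    (fun j k => mul_nonneg (norm_nonneg _) (by positivity))
    (fun i => mul_nonneg (hC₁0 i) (geomWeight_nonneg hA hB _))
    (fun i => hC₁ i (ν i)) fun j k hjk => hC₂ j k hjk (ν j) (ν k)

end SelbergParams

/-! ### Skew-symmetrized word kernels -/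

section Kernels

variable {n : ℕ}

/-- Multiplying `g` by the sign of the order of its indices makes it antisymmetric; the product over
pairs of an antisymmetric function changes by the sign of `σ`, which absolute values remove. -/
theorem prod_Ioi_comp_of_symm (σ : Equiv.Perm (Fin n)) {g : Fin n → Fin n → ℝ}
    (h0 : ∀ i j, 0 ≤ g i j) (hg : ∀ i j, g i j = g j i) :
    ∏ i, ∏ j ∈ Finset.Ioi i, g (σ i) (σ j) = ∏ i, ∏ j ∈ Finset.Ioi i, g i j := by
  let f : Fin n → Fin n → ℝ := fun i j => (if i < j then 1 else if j < i then -1 else 0) * g i j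
  have hf : ∀ i j, f i j = -f j i := fun i j => by
    simp only [f]
    rw [hg i j, ← neg_mul]
    congr 1
    rcases lt_trichotomy i j with h | h | h
    · simp [h, h.not_gt]
    · simp [h]
    · simp [h, h.not_gt]
  have habs : ∀ i j, i ≠ j → |f i j| = g i j := fun i j hij => by
    simp only [f]
    rw [abs_mul, abs_of_nonneg (h0 i j)]
    rcases hij.lt_or_gt with h | h
    · simp [h]
    · simp [h, h.not_gt]
  have key := congrArg abs (σ.prod_Ioi_comp_eq_sign_mul_prod hf)
  have hs : |((σ.sign : ℤ) : ℝ)| = 1 := by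
    rcases Int.units_eq_one_or σ.sign with h | h <;> simp [h]
  rw [abs_mul, hs, one_mul, Finset.abs_prod, Finset.abs_prod] at key
  simp only [Finset.abs_prod] at key
  have e1 : ∏ i, ∏ j ∈ Finset.Ioi i, |f (σ i) (σ j)| =
      ∏ i, ∏ j ∈ Finset.Ioi i, g (σ i) (σ j) :=
    Finset.prod_congr rfl fun i _ => Finset.prod_congr rfl fun j hj =>
      habs _ _ fun h => (Finset.mem_Ioi.1 hj).ne (σ.injective h)
  have e2 : ∏ i, ∏ j ∈ Finset.Ioi i, |f i j| = ∏ i, ∏ j ∈ Finset.Ioi i, g i j :=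
    Finset.prod_congr rfl fun i _ => Finset.prod_congr rfl fun j hj =>
      habs _ _ (Finset.mem_Ioi.1 hj).ne
  rw [← e1, key, e2]

theorem Tame.comp_perm {f : (Fin n → ℂ) → ℂ} (hf : Tame f) (σ : Equiv.Perm (Fin n)) :
    Tame fun z => f (z ∘ σ) := by
  obtain ⟨C, hC0, hC⟩ := hf
  refine ⟨C, hC0, fun z => (hC _).trans (le_of_eq ?_)⟩
  simp only [Function.comp_apply]
  rw [Equiv.prod_comp σ fun i => 1 + ‖z i‖ ^ 2,
    prod_Ioi_comp_of_symm σ (g := fun j k => ‖z j‖ + ‖z k‖) (fun _ _ => by positivity)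
      fun _ _ => add_comm _ _]

theorem Tame.const_mul {f : (Fin n → ℂ) → ℂ} (hf : Tame f) (c : ℂ) : Tame fun z => c * f z := by
  obtain ⟨C, hC0, hC⟩ := hf
  refine ⟨‖c‖ * C, by positivity, fun z => ?_⟩
  rw [norm_mul, mul_assoc]
  exact mul_le_mul_of_nonneg_left (hC z) (norm_nonneg _)

/-- The product `∏_{k<l} (z_k - t⁻¹ z_l)`. -/
def tVdm (t : ℂ) (z : Fin n → ℂ) : ℂ := ∏ k, ∏ l ∈ Finset.Ioi k, (z k - t⁻¹ * z l)

/-- The product of one-variable functions `L_i(z_i)` with `∏_{k<l} (z_k - t⁻¹ z_l)`. -/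
def wordKernel (t : ℂ) (L : Fin n → ℂ → ℂ) (z : Fin n → ℂ) : ℂ := (∏ i, L i (z i)) * tVdm t z

/-- One-variable functions of at most quadratic growth. -/
def QuadGrowth (f : ℂ → ℂ) : Prop := ∃ C : ℝ, 0 ≤ C ∧ ∀ z, ‖f z‖ ≤ C * (1 + ‖z‖ ^ 2)

theorem quadGrowth_of_eq {f : ℂ → ℂ} (a b c : ℂ) (h : ∀ z, f z = a + b * z + c * z ^ 2) :
    QuadGrowth f := by
  refine ⟨‖a‖ + ‖b‖ + ‖c‖, by positivity, fun z => ?_⟩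
  rw [h]
  refine (norm_add₃_le).trans ?_
  rw [norm_mul, norm_mul, norm_pow]
  have h1 : ‖z‖ ≤ 1 + ‖z‖ ^ 2 := by nlinarith [sq_nonneg (‖z‖ - 1), norm_nonneg z]
  have h2 := mul_le_mul_of_nonneg_left h1 (norm_nonneg b)
  have h3 : 0 ≤ ‖a‖ * ‖z‖ ^ 2 := by positivity
  have h4 := norm_nonneg c
  nlinarith

theorem tame_wordKernel (t : ℂ) {L : Fin n → ℂ → ℂ} (hL : ∀ i, QuadGrowth (L i)) :
    Tame (wordKernel t L) := by
  choose C hC0 hC using hL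
  refine ⟨(∏ i, C i) * ∏ j : Fin n, ∏ k ∈ Finset.Ioi j, (1 + ‖t⁻¹‖),
    mul_nonneg (Finset.prod_nonneg fun i _ => hC0 i) (by positivity), fun z => ?_⟩
  rw [wordKernel, tVdm, norm_mul, norm_prod, norm_prod]
  simp only [norm_prod]
  rw [mul_mul_mul_comm]
  refine mul_le_mul ?_ ?_ (Finset.prod_nonneg fun j _ => Finset.prod_nonneg fun _ _ =>
    norm_nonneg (z j - _)) (mul_nonneg (Finset.prod_nonneg fun i _ => hC0 i) (by positivity))
  · rw [← Finset.prod_mul_distrib]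
    exact Finset.prod_le_prod (fun i _ => norm_nonneg _) fun i _ => hC i _
  simp only [← Finset.prod_mul_distrib]
  refine Finset.prod_le_prod (fun j _ => Finset.prod_nonneg fun _ _ => norm_nonneg (z j - _))
    fun j _ => Finset.prod_le_prod (fun k _ => norm_nonneg _) fun k _ => ?_
  refine (norm_sub_le _ _).trans ?_
  rw [norm_mul]
  nlinarith [norm_nonneg (z j), norm_nonneg (z k), norm_nonneg t⁻¹,
    mul_nonneg (norm_nonneg t⁻¹) (norm_nonneg (z j))]

theorem skewSymm_comp_perm (f : (Fin n → ℂ) → ℂ) (τ : Equiv.Perm (Fin n)) (z : Fin n → ℂ) :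
    skewSymm (fun z => f (z ∘ τ)) z = ((Equiv.Perm.sign τ : ℤ) : ℂ) * skewSymm f z := by
  have hs : ((Equiv.Perm.sign τ : ℤ) : ℂ) * ((Equiv.Perm.sign τ : ℤ) : ℂ) = 1 := by
    rcases Int.units_eq_one_or (Equiv.Perm.sign τ) with h | h <;> simp [h]
  unfold skewSymm
  rw [← Equiv.sum_comp (Equiv.mulRight τ) fun σ =>
    ((Equiv.Perm.sign σ : ℤ) : ℂ) * f (z ∘ σ), Finset.mul_sum]
  refine Finset.sum_congr rfl fun σ _ => ?_
  simp only [Equiv.coe_mulRight, Equiv.Perm.sign_mul, Equiv.Perm.coe_mul, Function.comp_assoc,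
    Units.val_mul, Int.cast_mul]
  linear_combination (-((Equiv.Perm.sign σ : ℤ) : ℂ) * f (z ∘ ⇑σ ∘ ⇑τ)) * hs

theorem skewSymm_eq_zero_of_swap {f : (Fin n → ℂ) → ℂ} {i j : Fin n} (hij : i ≠ j)
    (h : ∀ z, f (z ∘ Equiv.swap i j) = f z) (z : Fin n → ℂ) : skewSymm f z = 0 := by
  have := skewSymm_comp_perm f (Equiv.swap i j) z
  simp only [h, Equiv.Perm.sign_swap hij] at this
  exact self_eq_neg.1 (by simpa using this)

/-- Since `i` and `j` are adjacent, their swap permutes the remaining pairs `k < l` among themselves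
and preserves their order. -/
theorem tVdm_comp_swap (t : ℂ) {i j : Fin n} (hij : (i : ℕ) + 1 = j) :
    ∃ g : (Fin n → ℂ) → ℂ, (∀ z, tVdm t z = (z i - t⁻¹ * z j) * g z) ∧
      ∀ z, g (z ∘ Equiv.swap i j) = g z := by
  let P := (Finset.univ.filter fun x : Fin n × Fin n => x.1 < x.2)
  have hP : (i, j) ∈ P := by
    simp only [P, Finset.mem_filter, Finset.mem_univ, true_and, Fin.lt_def]; omega
  refine ⟨fun z => ∏ x ∈ P.erase (i, j), (z x.1 - t⁻¹ * z x.2), fun z => ?_, fun z => ?_⟩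
  · rw [tVdm, prod_Ioi_eq_prod_filter fun k l => z k - t⁻¹ * z l, Finset.mul_prod_erase P
      (fun x => z x.1 - t⁻¹ * z x.2) hP]
  · refine Finset.prod_equiv ((Equiv.swap i j).prodCongr (Equiv.swap i j)) ?_ fun x _ => rfl
    rintro ⟨k, l⟩
    simp only [P, Finset.mem_erase, Finset.mem_filter, Finset.mem_univ, true_and, ne_eq,
      Prod.mk.injEq, Equiv.prodCongr_apply, Prod.map_apply, Equiv.swap_apply_def]
    simp only [Fin.lt_def, Fin.ext_iff]
    grind

/-- A factor `z` moves to the left neighbour at the price of `t⁻¹`. -/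
theorem skewSymm_wordKernel_move (t : ℂ) {i j : Fin n} (hij : (i : ℕ) + 1 = j)
    {L L' : Fin n → ℂ → ℂ} {l : ℂ → ℂ} (h : ∀ k, k ≠ i → k ≠ j → L k = L' k)
    (hi : L i = l) (hj : L j = fun z => z * l z) (hi' : L' i = fun z => z * l z) (hj' : L' j = l)
    (z : Fin n → ℂ) :
    skewSymm (wordKernel t L) z = t⁻¹ * skewSymm (wordKernel t L') z := by
  have hne : i ≠ j := fun h => by rw [h] at hij; omega
  obtain ⟨g, hg, hgs⟩ := tVdm_comp_swap t hij
  have hsplit : ∀ M : Fin n → ℂ → ℂ, ∀ z : Fin n → ℂ, ∏ k, M k (z k) =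
      M i (z i) * M j (z j) * ∏ k ∈ (Finset.univ.erase i).erase j, M k (z k) := fun M z => by
    rw [← Finset.mul_prod_erase Finset.univ _ (Finset.mem_univ i),
      ← Finset.mul_prod_erase (Finset.univ.erase i) _
        (Finset.mem_erase.2 ⟨hne.symm, Finset.mem_univ j⟩), mul_assoc]
  let R : (Fin n → ℂ) → ℂ := fun z => ∏ k ∈ (Finset.univ.erase i).erase j, L k (z k)
  have hR : ∀ z : Fin n → ℂ, R (z ∘ Equiv.swap i j) = R z := fun z =>
    Finset.prod_congr rfl fun k hk => by
      simp only [Finset.mem_erase, Finset.mem_univ, and_true] at hk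
      rw [Function.comp_apply, Equiv.swap_apply_of_ne_of_ne hk.2 hk.1]
  have e1 : ∀ z, wordKernel t L z =
      l (z i) * (z j * l (z j)) * R z * ((z i - t⁻¹ * z j) * g z) := fun z => by
    rw [wordKernel, hsplit L, hi, hj, hg]
  have e2 : ∀ z, wordKernel t L' z =
      (z i * l (z i)) * l (z j) * R z * ((z i - t⁻¹ * z j) * g z) := fun z => by
    have : R z = ∏ k ∈ (Finset.univ.erase i).erase j, L' k (z k) :=
      Finset.prod_congr rfl fun k hk => by
        simp only [Finset.mem_erase, Finset.mem_univ, and_true] at hk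
        rw [h k hk.2 hk.1]
    rw [this, wordKernel, hsplit L', hi', hj', hg]
  -- The difference equals `l(z_i) l(z_j) (z_i - t⁻¹ z_j)(z_j - t⁻¹ z_i)` times `R g`, which is
  -- invariant under the swap.
  have h0 := skewSymm_eq_zero_of_swap (f := fun z => wordKernel t L z - t⁻¹ * wordKernel t L' z)
    hne (fun z => by
      simp only [e1, e2, hR, hgs, Function.comp_apply, Equiv.swap_apply_left,
        Equiv.swap_apply_right]
      ring) z
  unfold skewSymm at h0 ⊢
  rw [← sub_eq_zero, Finset.mul_sum, ← Finset.sum_sub_distrib, ← h0]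
  exact Finset.sum_congr rfl fun σ _ => by ring

theorem tVdm_succ (t : ℂ) (z : Fin (n + 1) → ℂ) :
    tVdm t z = (∏ k : Fin n, (z 0 - t⁻¹ * z k.succ)) * tVdm t fun k => z k.succ := by
  simp [tVdm, Fin.prod_univ_succ, Fin.prod_Ioi_succ]

theorem tVdm_castSucc (t : ℂ) (z : Fin (n + 1) → ℂ) :
    tVdm t z = (∏ k : Fin n, (z k.castSucc - t⁻¹ * z (Fin.last n))) *
      tVdm t fun k => z k.castSucc := by
  have h : ∀ {m : ℕ} (w : Fin m → ℂ), tVdm t w =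
      ∏ k, ∏ l, if k < l then w k - t⁻¹ * w l else 1 := fun w =>
    Finset.prod_congr rfl fun k _ => by rw [← Finset.prod_filter, Finset.filter_lt_eq_Ioi]
  rw [h, h]
  simp [Fin.prod_univ_castSucc, Finset.prod_mul_distrib, Fin.castSucc_lt_last, mul_comm,
    not_lt.2 (Fin.le_last _)]

/-- The rotation puts `z_0` in the last slot, so its factors are `z_k - t⁻¹ z_0 = -t⁻¹ (z_0 - t
z_k)`. At `q z_0` these are the pair factors multiplying the shifted `Φ` in `Phi_add_single`. -/
theorem tVdm_finRotate {t : ℂ} (ht : t ≠ 0) (z : Fin (n + 1) → ℂ) :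
    tVdm t (z ∘ finRotate (n + 1)) =
      (-t⁻¹) ^ n * (∏ k : Fin n, (z 0 - t * z k.succ)) * tVdm t fun k => z k.succ := by
  have hc : ∀ k : Fin n, finRotate (n + 1) k.castSucc = k.succ := fun k => by
    rw [finRotate_apply]; simp
  rw [tVdm_castSucc]
  simp only [Function.comp_apply, hc, finRotate_last]
  congr 1
  have : (-t⁻¹) ^ n = ∏ _k : Fin n, (-t⁻¹) := by simp
  rw [this, ← Finset.prod_mul_distrib]
  exact Finset.prod_congr rfl fun k _ => by field_simp; ring

end Kernels

/-! ### The `q`-difference equations of `Φ` -/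

namespace SelbergParams

variable {p : SelbergParams} {n : ℕ}

/-- Stated without division because the factors with `a₁`, `a₂` may vanish on the lattice;
admissibility only concerns `b₁`, `b₂` and `t`. -/
theorem PhiOne_add_one (hq0 : p.q ≠ 0) (hq1 : ‖p.q‖ < 1) {x : ℂ}
    (h : ∀ m : ℤ, p.b₁ * x * p.q ^ m ≠ 1 ∧ p.b₂ * x * p.q ^ m ≠ 1) (m : ℤ) :
    p.PhiOne x (m + 1) * ((1 - p.a₁⁻¹ * (p.q * (x * p.q ^ m))) *
        (1 - p.a₂⁻¹ * (p.q * (x * p.q ^ m)))) =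
      p.PhiOne x m * (p.qα * ((1 - p.b₁ * (x * p.q ^ m)) * (1 - p.b₂ * (x * p.q ^ m)))) := by
  have e : x * p.q ^ (m + 1) = p.q * (x * p.q ^ m) := by rw [zpow_add_one₀ hq0]; ring
  have hb : ∀ b : ℂ, (∀ m : ℤ, b * x * p.q ^ m ≠ 1) →
      qPochInf p.q (b * (x * p.q ^ m)) ≠ 0 ∧
      qPochInf p.q (b * (p.q * (x * p.q ^ m))) ≠ 0 := fun b hb => by
    constructor <;> refine qPochInf_ne_zero hq1 fun i hi => ?_
    · refine hb (m + i) ?_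
      rw [← hi, zpow_add₀ hq0, zpow_natCast]; ring
    · refine hb (m + i + 1) ?_
      rw [← hi, zpow_add_one₀ hq0, zpow_add₀ hq0, zpow_natCast]; ring
  obtain ⟨h1, h1'⟩ := hb p.b₁ fun m => (h m).1
  obtain ⟨h2, h2'⟩ := hb p.b₂ fun m => (h m).2
  rw [PhiOne, PhiOne, e, latPow, latPow, show p.q ^ p.α = p.qα from rfl,
    zpow_add_one₀ (qα_ne_zero hq0)]
  generalize x * p.q ^ m = z at *
  have s : ∀ c : ℂ, qPochInf p.q (c * z) = (1 - c * z) * qPochInf p.q (c * (p.q * z)) :=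
    fun c => by rw [qPochInf_step hq1, mul_left_comm]
  rw [s (p.q * p.a₁⁻¹), s (p.q * p.a₂⁻¹)]
  rw [s p.b₁] at h1 ⊢
  rw [s p.b₂] at h2 ⊢
  obtain ⟨h3, -⟩ := mul_ne_zero_iff.1 h1
  obtain ⟨h4, -⟩ := mul_ne_zero_iff.1 h2
  clear h1 h2 hb s
  generalize 1 - p.b₁ * z = D₁ at *
  generalize 1 - p.b₂ * z = D₂ at *
  generalize qPochInf p.q (p.b₁ * (p.q * z)) = V₁ at *
  generalize qPochInf p.q (p.b₂ * (p.q * z)) = V₂ at *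
  rw [mul_comm p.q p.a₁⁻¹, mul_comm p.q p.a₂⁻¹]
  simp only [mul_assoc]
  generalize p.a₁⁻¹ * (p.q * z) = c₁
  generalize p.a₂⁻¹ * (p.q * z) = c₂
  field_simp

theorem PhiTwo_add_one_left (hq0 : p.q ≠ 0) (hq1 : ‖p.q‖ < 1) {x y : ℂ} (hx : x ≠ 0)
    (h : ∀ m : ℤ, p.t * (y / x) * p.q ^ m ≠ 1) (m l : ℤ) :
    p.PhiTwo x y (m + 1) l * (p.q * (x * p.q ^ m) - p.t * (y * p.q ^ l)) =
      p.PhiTwo x y m l * (p.t ^ 2 * (x * p.q ^ m - p.t⁻¹ * (y * p.q ^ l))) := by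
  have ht0 := t_ne_zero hq0
  have e : x * p.q ^ (m + 1) = p.q * (x * p.q ^ m) := by rw [zpow_add_one₀ hq0]; ring
  have hX : x * p.q ^ m ≠ 0 := mul_ne_zero hx (zpow_ne_zero _ hq0)
  have hc : p.q ^ (2 * p.τ - 1) ≠ 0 := by simp [Complex.cpow_eq_zero_iff, hq0]
  have h1 : 1 - p.t * (y * p.q ^ l / (p.q * (x * p.q ^ m))) ≠ 0 := fun h0 => h (l - m - 1) <| by
    rw [zpow_sub₀ hq0, zpow_sub₀ hq0, zpow_one]
    rw [← sub_eq_zero, ← neg_eq_zero, ← h0]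
    field_simp
    ring
  have h2 : qPochInf p.q (p.t * (y * p.q ^ l / (x * p.q ^ m))) ≠ 0 :=
    qPochInf_ne_zero hq1 fun i hi => h (l - m + i) <| by
      rw [zpow_add₀ hq0, zpow_sub₀ hq0, zpow_natCast, ← hi]
      field_simp
  rw [PhiTwo, PhiTwo, e, latPow, latPow, zpow_add_one₀ hc, cpow_two_mul_τ_sub_one hq0]
  generalize x * p.q ^ m = X at *
  generalize y * p.q ^ l = Y at *
  have s1 := qPochInf_step hq1 (p.q * p.t⁻¹ * (Y / (p.q * X)))
  have s2 := qPochInf_step hq1 (p.t * (Y / (p.q * X)))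
  have e1 : p.q * (p.q * p.t⁻¹ * (Y / (p.q * X))) = p.q * p.t⁻¹ * (Y / X) := by field_simp
  have e2 : p.q * (p.t * (Y / (p.q * X))) = p.t * (Y / X) := by field_simp
  rw [e1] at s1
  rw [e2] at s2
  rw [s1, s2]
  generalize qPochInf p.q (p.q * p.t⁻¹ * (Y / X)) = U at *
  generalize qPochInf p.q (p.t * (Y / X)) = V at *
  have h3 : p.q * X - p.t * Y = p.q * X * (1 - p.t * (Y / (p.q * X))) := by field_simp
  rw [h3]
  generalize 1 - p.t * (Y / (p.q * X)) = D at *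
  field_simp

/-- The relation is that of `PhiTwo_add_one_left` with the variables exchanged. The power
`z_j^(2τ-1)`, which changes only under a shift of the first variable, restores this symmetry, so the
total effect of shifting `z_i` does not depend on the position of `i`. -/
theorem PhiTwo_add_one_right (hq0 : p.q ≠ 0) (hq1 : ‖p.q‖ < 1) {x y : ℂ} (hx : x ≠ 0)
    (h : ∀ m : ℤ, p.t * (y / x) * p.q ^ m ≠ 1) (m l : ℤ) :
    p.PhiTwo x y m (l + 1) * (p.q * (y * p.q ^ l) - p.t * (x * p.q ^ m)) =
      p.PhiTwo x y m l * (p.t ^ 2 * (y * p.q ^ l - p.t⁻¹ * (x * p.q ^ m))) := by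
  have ht0 := t_ne_zero hq0
  have e : y * p.q ^ (l + 1) = p.q * (y * p.q ^ l) := by rw [zpow_add_one₀ hq0]; ring
  have hX : x * p.q ^ m ≠ 0 := mul_ne_zero hx (zpow_ne_zero _ hq0)
  have h1 : 1 - p.t * (y * p.q ^ l / (x * p.q ^ m)) ≠ 0 := fun h0 => h (l - m) <| by
    rw [zpow_sub₀ hq0, ← sub_eq_zero, ← neg_eq_zero, ← h0]
    field_simp
    ring
  have h2 : qPochInf p.q (p.t * (p.q * (y * p.q ^ l) / (x * p.q ^ m))) ≠ 0 :=
    qPochInf_ne_zero hq1 fun i hi => h (l - m + i + 1) <| by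
      rw [zpow_add_one₀ hq0, zpow_add₀ hq0, zpow_sub₀ hq0, zpow_natCast, ← hi]
      field_simp
  rw [PhiTwo, PhiTwo, e]
  generalize p.latPow x m (2 * p.τ - 1) = W
  generalize x * p.q ^ m = X at *
  generalize y * p.q ^ l = Y at *
  have s1 := qPochInf_step hq1 (p.q * p.t⁻¹ * (Y / X))
  have s2 := qPochInf_step hq1 (p.t * (Y / X))
  have e1 : p.q * (p.q * p.t⁻¹ * (Y / X)) = p.q * p.t⁻¹ * (p.q * Y / X) := by ring
  have e2 : p.q * (p.t * (Y / X)) = p.t * (p.q * Y / X) := by ring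
  rw [e1] at s1
  rw [e2] at s2
  rw [s1, s2]
  generalize qPochInf p.q (p.q * p.t⁻¹ * (p.q * Y / X)) = U at *
  generalize qPochInf p.q (p.t * (p.q * Y / X)) = V at *
  have h3 : p.t ^ 2 * (Y - p.t⁻¹ * X) = -(p.t * X) * (1 - p.t * (Y / X)) := by field_simp; ring
  rw [h3]
  generalize 1 - p.t * (Y / X) = D at *
  field_simp
  ring

/-- The pairs `j < k` containing `i`, collected into a single product. -/
theorem prod_Ioi_pairs_through {n : ℕ} (i : Fin n) (c : Fin n → ℂ) :
    ∏ j, ∏ k ∈ Finset.Ioi j, (if j = i then c k else if k = i then c j else 1) =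
      ∏ k, if k = i then 1 else c k := by
  have h : ∏ j, ∏ k ∈ Finset.Ioi j, (if j = i then c k else if k = i then c j else 1) =
      ∏ j, ∏ k ∈ Finset.Ioi j, ((if j = i then c k else 1) * (if k = i then c j else 1)) := by
    refine Finset.prod_congr rfl fun j _ => Finset.prod_congr rfl fun k hk => ?_
    have := (Finset.mem_Ioi.1 hk).ne
    split_ifs with h1 h2 <;> simp_all
  rw [h]
  simp only [Finset.prod_mul_distrib]
  have h1 : ∏ j, ∏ k ∈ Finset.Ioi j, (if j = i then c k else 1) =
      ∏ k, if i < k then c k else 1 := by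
    rw [Finset.prod_eq_single i (fun j _ hj => by simp [hj]) (by simp),
      ← Finset.prod_filter (fun k => i < k), Finset.filter_lt_eq_Ioi]
    simp
  have h2 : ∏ j, ∏ k ∈ Finset.Ioi j, (if k = i then c j else 1) =
      ∏ j, if j < i then c j else 1 :=
    Finset.prod_congr rfl fun j _ => by simp [Finset.prod_ite_eq']
  rw [h1, h2, ← Finset.prod_mul_distrib]
  refine Finset.prod_congr rfl fun k _ => ?_
  rcases lt_trichotomy k i with h | h | h
  · simp [h, h.not_gt, h.ne]
  · simp [h]
  · simp [h, h.not_gt, h.ne']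

theorem pt_add_single_self (hq0 : p.q ≠ 0) (ξ : Fin n → ℂ) (ν : Fin n → ℤ) (i : Fin n) :
    p.pt ξ (ν + Pi.single i 1) i = p.q * p.pt ξ ν i := by
  simp [pt, zpow_add_one₀ hq0]; ring

theorem pt_add_single_of_ne (ξ : Fin n → ℂ) (ν : Fin n → ℤ) {i j : Fin n} (h : j ≠ i) :
    p.pt ξ (ν + Pi.single i 1) j = p.pt ξ ν j := by
  simp [pt, h]

theorem Phi_add_single (hq0 : p.q ≠ 0) (hq1 : ‖p.q‖ < 1) {ξ : Fin n → ℂ} (hξ : p.Admissible ξ)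
    (ν : Fin n → ℤ) (i : Fin n) :
    p.Phi ξ (ν + Pi.single i 1) * ((1 - p.a₁⁻¹ * (p.q * p.pt ξ ν i)) *
        (1 - p.a₂⁻¹ * (p.q * p.pt ξ ν i)) *
        ∏ k, if k = i then 1 else p.q * p.pt ξ ν i - p.t * p.pt ξ ν k) =
      p.Phi ξ ν * (p.qα * ((1 - p.b₁ * p.pt ξ ν i) * (1 - p.b₂ * p.pt ξ ν i)) *
        ∏ k, if k = i then 1 else p.t ^ 2 * (p.pt ξ ν i - p.t⁻¹ * p.pt ξ ν k)) := by
  rw [← prod_Ioi_pairs_through i, ← prod_Ioi_pairs_through i]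
  have single : ∀ a : ℂ, a = ∏ k, if k = i then a else 1 := fun a => by simp
  rw [single ((1 - p.a₁⁻¹ * (p.q * p.pt ξ ν i)) * _), single (p.qα * _), Phi_eq, Phi_eq,
    mul_mul_mul_comm, mul_mul_mul_comm (∏ k, p.PhiOne (ξ k) (ν k))]
  congr 1
  · rw [← Finset.prod_mul_distrib, ← Finset.prod_mul_distrib]
    refine Finset.prod_congr rfl fun k _ => ?_
    split_ifs with h
    · subst h
      simpa [pt] using PhiOne_add_one hq0 hq1 (hξ.2.1 k) (ν k)
    · simp [h]
  · simp only [← Finset.prod_mul_distrib]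
    refine Finset.prod_congr rfl fun j _ => Finset.prod_congr rfl fun k hk => ?_
    have hjk := Finset.mem_Ioi.1 hk
    split_ifs with h h'
    · subst h
      simpa [pt, hjk.ne'] using PhiTwo_add_one_left hq0 hq1 (hξ.1 j) (hξ.2.2 j k hjk) (ν j) (ν k)
    · subst h'
      simpa [pt, hjk.ne] using PhiTwo_add_one_right hq0 hq1 (hξ.1 j) (hξ.2.2 j k hjk) (ν j) (ν k)
    · simp [h, h']

/-! ### Jackson sums of words and rotation of letters -/

/-- The Jackson sum of the skew-symmetrization of `f` against `Φ`. -/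
def skewSum (p : SelbergParams) (ξ : Fin n → ℂ) (f : (Fin n → ℂ) → ℂ) : ℂ :=
  ∑' ν : Fin n → ℤ, skewSymm f (p.pt ξ ν) * p.Phi ξ ν

theorem summable_skewSymm_mul_Phi (hp : p.Good n) {ξ : Fin n → ℂ} (hξ : p.Admissible ξ)
    {f : (Fin n → ℂ) → ℂ} (hf : Tame f) :
    Summable fun ν => skewSymm f (p.pt ξ ν) * p.Phi ξ ν := by
  unfold skewSymm
  simp only [Finset.sum_mul, mul_assoc]
  exact summable_sum fun σ _ => (summable_mul_Phi hp hξ (hf.comp_perm σ)).mul_left _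

/-- The sum is split by permutation because the rotation argument shifts a different lattice
direction for each `σ`; the splitting uses summability of every permuted term. -/
theorem skewSum_eq_sum (hp : p.Good n) {ξ : Fin n → ℂ} (hξ : p.Admissible ξ)
    {f : (Fin n → ℂ) → ℂ} (hf : Tame f) :
    p.skewSum ξ f = ∑ σ : Equiv.Perm (Fin n), ((Equiv.Perm.sign σ : ℤ) : ℂ) *
      ∑' ν : Fin n → ℤ, f (p.pt ξ ν ∘ σ) * p.Phi ξ ν := by
  unfold skewSum skewSymm
  simp only [Finset.sum_mul, mul_assoc]
  rw [Summable.tsum_finsetSum fun σ _ => (summable_mul_Phi hp hξ (hf.comp_perm σ)).mul_left _]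
  simp only [tsum_mul_left]

theorem skewSum_add (hp : p.Good n) {ξ : Fin n → ℂ} (hξ : p.Admissible ξ)
    {f g : (Fin n → ℂ) → ℂ} (hf : Tame f) (hg : Tame g) :
    p.skewSum ξ (fun z => f z + g z) = p.skewSum ξ f + p.skewSum ξ g := by
  unfold skewSum
  rw [← (summable_skewSymm_mul_Phi hp hξ hf).tsum_add (summable_skewSymm_mul_Phi hp hξ hg)]
  refine tsum_congr fun ν => ?_
  simp only [skewSymm, mul_add, Finset.sum_add_distrib, add_mul]

theorem skewSum_const_mul (ξ : Fin n → ℂ) (c : ℂ) (f : (Fin n → ℂ) → ℂ) :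
    p.skewSum ξ (fun z => c * f z) = c * p.skewSum ξ f := by
  unfold skewSum
  rw [← tsum_mul_left]
  refine tsum_congr fun ν => ?_
  simp only [skewSymm]
  rw [← mul_assoc, Finset.mul_sum]
  congr 1
  exact Finset.sum_congr rfl fun _ _ => by ring

/-- The `q`-shift of one variable moves the last letter of a word to the front. -/
theorem skewSum_wordKernel_rotate {N : ℕ} (hp : p.Good (N + 1)) {ξ : Fin (N + 1) → ℂ}
    (hξ : p.Admissible ξ) {h : Fin N → ℂ → ℂ} (hh : ∀ i, QuadGrowth (h i)) :
    p.skewSum ξ (wordKernel p.t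
        (Fin.snoc h (fun z => (1 - p.a₁⁻¹ * z) * (1 - p.a₂⁻¹ * z)) : Fin (N + 1) → ℂ → ℂ)) =
      p.qα * p.t ^ N * p.skewSum ξ (wordKernel p.t
        (Fin.cons (fun z => (1 - p.b₁ * z) * (1 - p.b₂ * z)) h : Fin (N + 1) → ℂ → ℂ)) := by
  have hq0 := hp.q_ne
  have ht0 := t_ne_zero hq0
  set u : ℂ → ℂ := fun z => (1 - p.a₁⁻¹ * z) * (1 - p.a₂⁻¹ * z) with hu
  set v : ℂ → ℂ := fun z => (1 - p.b₁ * z) * (1 - p.b₂ * z) with hv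
  have hu' : QuadGrowth u := quadGrowth_of_eq 1 (-p.a₁⁻¹ - p.a₂⁻¹) (p.a₁⁻¹ * p.a₂⁻¹)
    fun z => by simp only [hu]; ring
  have hv' : QuadGrowth v := quadGrowth_of_eq 1 (-p.b₁ - p.b₂) (p.b₁ * p.b₂)
    fun z => by simp only [hv]; ring
  set f₁ := wordKernel p.t (Fin.snoc h u : Fin (N + 1) → ℂ → ℂ) with hf₁
  set f₂ := wordKernel p.t (Fin.cons v h : Fin (N + 1) → ℂ → ℂ) with hf₂
  have hT₁ : Tame f₁ := tame_wordKernel _ fun i => by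
    refine Fin.lastCases ?_ (fun i => ?_) i
    · simpa using hu'
    · simpa using hh i
  have hT₂ : Tame f₂ := tame_wordKernel _ fun i => by
    refine Fin.cases ?_ (fun i => ?_) i
    · simpa using hv'
    · simpa using hh i
  let G : (Fin N → ℂ) → ℂ := fun y => (∏ k, h k (y k)) * tVdm p.t y
  have hc : ∀ k : Fin N, finRotate (N + 1) k.castSucc = k.succ := fun k => by
    rw [finRotate_apply]; simp
  have e₁ : ∀ z : Fin (N + 1) → ℂ, f₁ (z ∘ finRotate (N + 1)) = (-p.t⁻¹) ^ N *
      (u (z 0) * (∏ k : Fin N, (z 0 - p.t * z k.succ)) * G fun k => z k.succ) := fun z => by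
    rw [hf₁, wordKernel, tVdm_finRotate ht0, Fin.prod_univ_castSucc]
    simp only [Fin.snoc_castSucc, Fin.snoc_last, Function.comp_apply, hc, finRotate_last, G]
    ring
  have e₂ : ∀ z : Fin (N + 1) → ℂ, f₂ z =
      v (z 0) * (∏ k : Fin N, (z 0 - p.t⁻¹ * z k.succ)) * G fun k => z k.succ := fun z => by
    rw [hf₂, wordKernel, tVdm_succ, Fin.prod_univ_succ]
    simp only [Fin.cons_zero, Fin.cons_succ, G]
    ring
  have hrot : p.skewSum ξ f₁ = (-1) ^ N * p.skewSum ξ fun z => f₁ (z ∘ finRotate (N + 1)) := by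
    unfold skewSum
    rw [← tsum_mul_left]
    refine tsum_congr fun ν => ?_
    have hs : ((Equiv.Perm.sign (finRotate (N + 1)) : ℤ) : ℂ) = (-1) ^ N := by
      rw [sign_finRotate]; simp
    rw [skewSymm_comp_perm, hs, ← mul_assoc, ← mul_assoc, ← mul_pow]
    simp
  have hpt : ∀ (σ : Equiv.Perm (Fin (N + 1))) (ν : Fin (N + 1) → ℤ),
      f₁ ((p.pt ξ (ν + Pi.single (σ 0) 1) ∘ σ) ∘ finRotate (N + 1)) *
        p.Phi ξ (ν + Pi.single (σ 0) 1) =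
      (-1) ^ N * (p.qα * p.t ^ N) * (f₂ (p.pt ξ ν ∘ σ) * p.Phi ξ ν) := fun σ ν => by
    have hpair : ∀ c : Fin (N + 1) → ℂ,
        ∏ k, (if k = σ 0 then 1 else c k) = ∏ k : Fin N, c (σ k.succ) := fun c => by
      rw [← Equiv.prod_comp σ, Fin.prod_univ_succ]
      simp [Fin.succ_ne_zero]
    have hne : ∀ k : Fin N, σ k.succ ≠ σ 0 := fun k h => Fin.succ_ne_zero k (σ.injective h)
    have key := Phi_add_single hq0 hp.q_lt hξ ν (σ 0)
    rw [hpair, hpair, Finset.prod_mul_distrib, Finset.prod_const, Finset.card_univ,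
      Fintype.card_fin] at key
    rw [e₁, e₂]
    simp only [Function.comp_apply, pt_add_single_self hq0, pt_add_single_of_ne _ _ (hne _)]
    -- Here `(-t⁻¹)^N` comes from the rotated kernel and `t^(2N)` from shifting `Φ`. The remaining
    -- sign cancels against the sign of the cyclic permutation in `hrot`.
    have hpow : (-p.t⁻¹) ^ N * (p.t ^ 2) ^ N = (-1) ^ N * p.t ^ N := by
      rw [← mul_pow, ← mul_pow]
      congr 1
      field_simp
    simp only [hu, hv]
    linear_combination (-p.t⁻¹) ^ N * (G fun k => p.pt ξ ν (σ k.succ)) * key +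
      p.Phi ξ ν * (p.qα * ((1 - p.b₁ * p.pt ξ ν (σ 0)) * (1 - p.b₂ * p.pt ξ ν (σ 0)))) *
        (∏ k : Fin N, (p.pt ξ ν (σ 0) - p.t⁻¹ * p.pt ξ ν (σ k.succ))) *
        (G fun k => p.pt ξ ν (σ k.succ)) * hpow
  rw [hrot, skewSum_eq_sum hp hξ (hT₁.comp_perm _), skewSum_eq_sum hp hξ hT₂, Finset.mul_sum,
    Finset.mul_sum]
  refine Finset.sum_congr rfl fun σ _ => ?_
  -- Invariance of the lattice under `z_{σ(0)} ↦ q z_{σ(0)}`.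
  rw [← (Equiv.addRight (Pi.single (σ 0) (1 : ℤ))).tsum_eq]
  simp only [Equiv.coe_addRight, hpt, tsum_mul_left]
  have h1 : ((-1 : ℂ) ^ N) * (-1) ^ N = 1 := by rw [← mul_pow]; simp
  linear_combination ((Equiv.Perm.sign σ : ℤ) : ℂ) * (p.qα * p.t ^ N) *
    (∑' ν : Fin (N + 1) → ℤ, f₂ (p.pt ξ ν ∘ σ) * p.Phi ξ ν) * h1

/-- The letter at position `i`: `1 - b₂ z` before the cut `c` and `1 - z / a₁` after it, with an
additional factor `z` at the positions in `Z`. -/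
def letter (p : SelbergParams) (Z : Finset ℕ) (c i : ℕ) (z : ℂ) : ℂ :=
  (if i ∈ Z then z else 1) * (if i < c then 1 - p.b₂ * z else 1 - p.a₁⁻¹ * z)

theorem quadGrowth_letter (Z : Finset ℕ) (c i : ℕ) : QuadGrowth (p.letter Z c i) := by
  by_cases h : i ∈ Z <;> by_cases h' : i < c
  · exact quadGrowth_of_eq 0 1 (-p.b₂) fun z => by simp [letter, h, h']; ring
  · exact quadGrowth_of_eq 0 1 (-p.a₁⁻¹) fun z => by simp [letter, h, h']; ring
  · exact quadGrowth_of_eq 1 (-p.b₂) 0 fun z => by simp [letter, h, h']; ring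
  · exact quadGrowth_of_eq 1 (-p.a₁⁻¹) 0 fun z => by simp [letter, h, h']; ring

/-- The Jackson sum of the word with letters `letter Z c`. -/
def word (p : SelbergParams) (ξ : Fin n → ℂ) (Z : Finset ℕ) (c : ℕ) : ℂ :=
  p.skewSum ξ (wordKernel p.t fun i : Fin n => p.letter Z c i)

/-- The condition `c ≠ r + 1` keeps both positions on the same side of the cut, so their letters
agree up to the factor `z`. -/
theorem word_move (ξ : Fin n → ℂ) {Z : Finset ℕ} {c r : ℕ} (h : r ∉ Z) (h' : r + 1 ∉ Z)
    (hr : r + 1 < n) (hc : c ≠ r + 1) :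
    p.word ξ (insert (r + 1) Z) c = p.t⁻¹ * p.word ξ (insert r Z) c := by
  unfold word
  rw [← skewSum_const_mul]
  unfold skewSum
  refine tsum_congr fun ν => ?_
  congr 1
  rw [skewSymm_wordKernel_move p.t (i := ⟨r, by omega⟩) (j := ⟨r + 1, hr⟩) rfl
    (L' := fun i : Fin n => p.letter (insert r Z) c i)
    (l := fun z => if r < c then 1 - p.b₂ * z else 1 - p.a₁⁻¹ * z)]
  · unfold skewSymm
    rw [Finset.mul_sum]
    exact Finset.sum_congr rfl fun _ _ => by ring
  · intro k hk hk'
    have h1 : (k : ℕ) ≠ r := fun h => hk (Fin.ext h)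
    have h2 : (k : ℕ) ≠ r + 1 := fun h => hk' (Fin.ext h)
    ext z
    simp [letter, h1, h2]
  · ext z
    simp [letter, h]
  · ext z
    have : r + 1 < c ↔ r < c := by omega
    simp [letter, this]
  · ext z
    simp [letter]
  · ext z
    have : r + 1 < c ↔ r < c := by omega
    simp [letter, h', this]

theorem word_move_many (ξ : Fin n → ℂ) {Z : Finset ℕ} {c r : ℕ} (m : ℕ)
    (h : ∀ i, r ≤ i → i ≤ r + m → i ∉ Z) (hr : r + m < n) (hc : c ≤ r ∨ r + m < c) :
    p.word ξ (insert (r + m) Z) c = p.t⁻¹ ^ m * p.word ξ (insert r Z) c := by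
  induction m with
  | zero => simp
  | succ m ih =>
    rw [← add_assoc, word_move ξ (h _ (by omega) (by omega)) (h _ (by omega) (by omega))
      (by omega) (by omega), ih (fun i h1 h2 => h i h1 (by omega)) (by omega) (by omega), pow_succ']
    ring

/-- A missing factor travels to the right as the factors `z` next to it step to the left, each at
the price `t⁻¹`. -/
theorem word_hole (ξ : Fin n → ℂ) {k c r : ℕ} (m : ℕ) (hk : k ≤ n) (hr : r + m < k)
    (hc : c ≤ r ∨ r + m < c) :
    p.word ξ ((Finset.range k).erase r) c =
      p.t⁻¹ ^ m * p.word ξ ((Finset.range k).erase (r + m)) c := by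
  induction m with
  | zero => simp
  | succ m ih =>
    have h1 : (Finset.range k).erase (r + m) =
        insert (r + m + 1) (((Finset.range k).erase (r + m)).erase (r + m + 1)) := by
      rw [Finset.insert_erase]
      simp; omega
    have h2 : (Finset.range k).erase (r + m + 1) =
        insert (r + m) (((Finset.range k).erase (r + m)).erase (r + m + 1)) := by
      rw [Finset.erase_right_comm, Finset.insert_erase]
      simp; omega
    rw [ih (by omega) (by omega), h1, word_move ξ (by simp) (by simp) (by omega) (by omega), ← h2,
      pow_succ, ← add_assoc]
    ring

theorem skewSum_wordKernel_linear (hp : p.Good n) {ξ : Fin n → ℂ} (hξ : p.Admissible ξ) (i : Fin n)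
    {L L₁ L₂ L₃ : Fin n → ℂ → ℂ} (c₁ c₂ c₃ : ℂ) (h₁ : ∀ k, QuadGrowth (L₁ k))
    (h₂ : ∀ k, QuadGrowth (L₂ k)) (h₃ : ∀ k, QuadGrowth (L₃ k))
    (h : ∀ k, k ≠ i → L₁ k = L k ∧ L₂ k = L k ∧ L₃ k = L k)
    (hi : ∀ z, L i z = c₁ * L₁ i z + (c₂ * L₂ i z + c₃ * L₃ i z)) :
    p.skewSum ξ (wordKernel p.t L) = c₁ * p.skewSum ξ (wordKernel p.t L₁) +
      (c₂ * p.skewSum ξ (wordKernel p.t L₂) + c₃ * p.skewSum ξ (wordKernel p.t L₃)) := by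
  have T₁ := (tame_wordKernel p.t h₁).const_mul c₁
  have T₂ := (tame_wordKernel p.t h₂).const_mul c₂
  have T₃ := (tame_wordKernel p.t h₃).const_mul c₃
  have T₂₃ : Tame fun z => c₂ * wordKernel p.t L₂ z + c₃ * wordKernel p.t L₃ z := by
    obtain ⟨C, hC0, hC⟩ := T₂
    obtain ⟨C', hC0', hC'⟩ := T₃
    exact ⟨C + C', by positivity, fun z => (norm_add_le _ _).trans (by
      rw [add_mul]; exact add_le_add (hC z) (hC' z))⟩
  rw [← skewSum_const_mul, ← skewSum_const_mul, ← skewSum_const_mul, ← skewSum_add hp hξ T₂ T₃,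
    ← skewSum_add hp hξ T₁ T₂₃]
  congr 1
  ext z
  have hs : ∀ M : Fin n → ℂ → ℂ, (∀ k, k ≠ i → M k = L k) → wordKernel p.t M z =
      M i (z i) * ((∏ k ∈ Finset.univ.erase i, L k (z k)) * tVdm p.t z) := fun M hM => by
    rw [wordKernel, ← Finset.mul_prod_erase Finset.univ _ (Finset.mem_univ i), mul_assoc]
    congr 2
    exact Finset.prod_congr rfl fun k hk => by rw [hM k (Finset.ne_of_mem_erase hk)]
  rw [hs L fun _ _ => rfl, hs L₁ fun k hk => (h k hk).1, hs L₂ fun k hk => (h k hk).2.1,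
    hs L₃ fun k hk => (h k hk).2.2, hi]
  ring

/-- Lets a factor `z` cross the cut, by `z(1 - z/a₁) = (a₁b₂)⁻¹ z(1 - b₂z) - b₂⁻¹(1 - b₂z) + b₂⁻¹(1
- z/a₁)` at position `c`. Passing from `1 - z/a₁` to `1 - b₂z` there moves the cut to `c + 1`. -/
theorem word_subst (hp : p.Good n) {ξ : Fin n → ℂ} (hξ : p.Admissible ξ) {Z : Finset ℕ} {c : ℕ}
    (hc : c < n) (hZ : c ∉ Z) :
    p.word ξ (insert c Z) c = (p.a₁ * p.b₂)⁻¹ * p.word ξ (insert c Z) (c + 1) +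
      (-p.b₂⁻¹ * p.word ξ Z (c + 1) + p.b₂⁻¹ * p.word ξ Z c) := by
  have ha := hp.a₁_ne
  have hb := hp.b₂_ne
  refine skewSum_wordKernel_linear hp hξ ⟨c, hc⟩ _ _ _ (fun k => quadGrowth_letter _ _ _)
    (fun k => quadGrowth_letter _ _ _) (fun k => quadGrowth_letter _ _ _) (fun k hk => ?_)
    fun z => ?_
  · have h1 : (k : ℕ) ≠ c := fun h => hk (Fin.ext h)
    have h2 : (k : ℕ) < c + 1 ↔ (k : ℕ) < c := by omega
    refine ⟨?_, ?_, ?_⟩ <;> ext z <;> simp [letter, h1, h2]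
  · simp [letter, hZ]
    field_simp
    ring

/-- The rotation with both quadratic letters expanded, keeping `1 - z/a₁` at the end and `1 - b₂z`
at the front. All other letters step one place to the right, so the cut becomes `c + 1` and the
factors `z` occupy `1, …, k`. -/
theorem word_rotate {N : ℕ} (hp : p.Good (N + 1)) {ξ : Fin (N + 1) → ℂ} (hξ : p.Admissible ξ)
    {k c : ℕ} (hk : k ≤ N) (hc : c ≤ N) :
    p.word ξ (Finset.range k) c - p.a₂⁻¹ * p.word ξ (insert N (Finset.range k)) c =
      p.qα * p.t ^ N * (p.word ξ ((Finset.range (k + 1)).erase 0) (c + 1) -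
        p.b₁ * p.word ξ (Finset.range (k + 1)) (c + 1)) := by
  have key := skewSum_wordKernel_rotate hp hξ (h := fun i : Fin N => p.letter (Finset.range k) c i)
    fun i => quadGrowth_letter _ _ _
  -- Only two terms are needed; the third has coefficient `0`.
  have h1 := skewSum_wordKernel_linear hp hξ (Fin.last N)
    (L := Fin.snoc (fun i : Fin N => p.letter (Finset.range k) c i)
      fun z => (1 - p.a₁⁻¹ * z) * (1 - p.a₂⁻¹ * z))
    (L₁ := fun i => p.letter (Finset.range k) c i)
    (L₂ := fun i => p.letter (insert N (Finset.range k)) c i)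
    (L₃ := fun i => p.letter (Finset.range k) c i) 1 (-p.a₂⁻¹) 0
    (fun k => quadGrowth_letter _ _ _) (fun k => quadGrowth_letter _ _ _)
    (fun k => quadGrowth_letter _ _ _) (fun i => by
      refine Fin.lastCases (fun h => absurd rfl h) (fun i _ => ?_) i
      have := i.2.ne
      refine ⟨?_, ?_, ?_⟩ <;> ext z <;> simp [letter, this])
    (fun z => by
      simp [letter, not_lt.2 hk, not_lt.2 hc]
      ring)
  have h2 := skewSum_wordKernel_linear hp hξ 0
    (L := Fin.cons (fun z => (1 - p.b₁ * z) * (1 - p.b₂ * z))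
      fun i : Fin N => p.letter (Finset.range k) c i)
    (L₁ := fun i => p.letter ((Finset.range (k + 1)).erase 0) (c + 1) i)
    (L₂ := fun i => p.letter (Finset.range (k + 1)) (c + 1) i)
    (L₃ := fun i => p.letter (Finset.range (k + 1)) (c + 1) i) 1 (-p.b₁) 0
    (fun k => quadGrowth_letter _ _ _) (fun k => quadGrowth_letter _ _ _)
    (fun k => quadGrowth_letter _ _ _) (fun i => by
      refine Fin.cases (fun h => absurd rfl h) (fun i _ => ?_) i
      refine ⟨?_, ?_, ?_⟩ <;> ext z <;> simp [letter])
    (fun z => by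
      simp [letter]
      ring)
  rw [h1, h2] at key
  unfold word
  linear_combination key

/-! ### Recurrences on the two sides of the antidiagonal `k + j = n` -/

/-- The Jackson sums of the interpolation polynomials, whose first `k` letters carry a factor `z`
and whose last `j` letters are `1 - z / a₁`. -/
def interp (p : SelbergParams) (ξ : Fin n → ℂ) (k j : ℕ) : ℂ :=
  p.word ξ (Finset.range k) (n - j)

/-- Rotate with the cut at `k + d`, at or beyond the block of factors `z`. The factor `z` in the
last letter moves left to the cut, crosses it by `word_subst` and moves on to join the block. On the
other side the hole at `0` moves to the end of the block. Only three words remain. -/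
theorem interp_lower (hp : p.Good n) {ξ : Fin n → ℂ} (hξ : p.Admissible ξ) {k d j : ℕ}
    (hn : k + d + j + 1 = n) :
    (1 - p.qα * p.a₁ * p.a₂ * p.b₁ * p.b₂ * p.t ^ (k + 2 * d + 2 * j)) * p.interp ξ (k + 1) j =
      p.a₁ * p.t ^ d * ((1 - p.qα * p.a₂ * p.b₂ * p.t ^ (d + 2 * j)) * p.interp ξ k j -
        (1 - p.a₂ * p.b₂ * p.t ^ j) * p.interp ξ k (j + 1)) := by
  subst hn
  have ht := t_ne_zero hp.q_ne
  have ha₁ := hp.a₁_ne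
  have ha₂ := hp.a₂_ne
  have hb₂ := hp.b₂_ne
  have h0 := word_rotate hp hξ (k := k) (c := k + d) (by omega) (by omega)
  have h1 := word_move_many (p := p) ξ (Z := Finset.range k) (c := k + d) (r := k + d) j
    (fun i h _ => by simp; omega) (by omega) (Or.inl le_rfl)
  have h2 := word_subst hp hξ (Z := Finset.range k) (c := k + d) (by omega) (by simp)
  have h3 := word_move_many (p := p) ξ (Z := Finset.range k) (c := k + d + 1) (r := k) d
    (fun i h _ => by simp; omega) (by omega) (Or.inr (by omega))
  have h4 := word_hole (p := p) ξ (k := k + 1) (c := k + d + 1) (r := 0) k (by omega) (by omega)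
    (Or.inr (by omega))
  have h5 : insert k (Finset.range k) = Finset.range (k + 1) := Finset.range_add_one.symm
  have h6 : (Finset.range (k + 1)).erase (0 + k) = Finset.range k := by
    rw [zero_add, Finset.range_add_one, Finset.erase_insert (by simp)]
  rw [h5] at h3
  rw [h6] at h4
  rw [h1, h2, h3, h4] at h0
  have i1 : p.interp ξ (k + 1) j = p.word ξ (Finset.range (k + 1)) (k + d + 1) := by
    rw [interp]; congr 1; omega
  have i2 : p.interp ξ k j = p.word ξ (Finset.range k) (k + d + 1) := by
    rw [interp]; congr 1; omega
  have i3 : p.interp ξ k (j + 1) = p.word ξ (Finset.range k) (k + d) := by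
    rw [interp]; congr 1; omega
  rw [i1, i2, i3]
  simp only [pow_add, pow_mul', inv_pow] at h0 ⊢
  generalize p.word ξ (Finset.range (k + 1)) (k + d + 1) = w₁ at *
  generalize p.word ξ (Finset.range k) (k + d + 1) = w₂ at *
  generalize p.word ξ (Finset.range k) (k + d) = w₃ at *
  have hK : p.t ^ k ≠ 0 := pow_ne_zero _ ht
  have hD : p.t ^ d ≠ 0 := pow_ne_zero _ ht
  have hJ : p.t ^ j ≠ 0 := pow_ne_zero _ ht
  generalize p.t ^ k = K at *
  generalize p.t ^ d = D at *
  generalize p.t ^ j = J at *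
  rw [← sub_eq_zero] at h0 ⊢
  rw [← mul_zero (-(p.a₁ * p.a₂ * p.b₂ * J * D)), ← h0]
  field_simp
  ring

/-- Now the cut `c` lies inside the block or at its end. The factor `z` in the last letter joins the
block without crossing the cut. The hole at `0` moves to position `c`, crosses the cut by
`word_subst` solved for the word with the hole (`h8`), and moves on to the end of the block. -/
theorem interp_upper (hp : p.Good n) {ξ : Fin n → ℂ} (hξ : p.Admissible ξ) {c d w : ℕ}
    (hn : c + d + w + 1 = n) :
    (1 - p.qα * p.a₂ * p.b₂ * p.t ^ (d + 2 * w)) * p.interp ξ (c + d + 1) (d + w + 1) =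
      p.a₂ * p.t ^ w * (1 - p.qα * p.t ^ w) * p.interp ξ (c + d) (d + w + 1) -
        p.qα * p.a₂ * p.a₁⁻¹ * p.t ^ (d + 2 * w) * (1 - p.a₁ * p.b₁ * p.t ^ c) *
          p.interp ξ (c + d + 1) (d + w) := by
  subst hn
  have ht := t_ne_zero hp.q_ne
  have ha₁ := hp.a₁_ne
  have ha₂ := hp.a₂_ne
  have hb₂ := hp.b₂_ne
  have h0 := word_rotate hp hξ (k := c + d) (c := c) (by omega) (by omega)
  have h1 := word_move_many (p := p) ξ (Z := Finset.range (c + d)) (c := c) (r := c + d) w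
    (fun i h _ => by simp; omega) (by omega) (Or.inl (by omega))
  have h2 := word_hole (p := p) ξ (k := c + d + 1) (c := c + 1) (r := 0) c (by omega) (by omega)
    (Or.inr (by omega))
  have h3 := word_subst hp hξ (Z := (Finset.range (c + d + 1)).erase c) (c := c) (by omega) (by simp)
  have h4 := word_hole (p := p) ξ (k := c + d + 1) (c := c) (r := c) d (by omega) (by omega)
    (Or.inl le_rfl)
  have h5 : insert (c + d) (Finset.range (c + d)) = Finset.range (c + d + 1) :=
    Finset.range_add_one.symm
  have h6 : (Finset.range (c + d + 1)).erase (c + d) = Finset.range (c + d) := by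
    rw [Finset.range_add_one, Finset.erase_insert (by simp)]
  have h7 : insert c ((Finset.range (c + d + 1)).erase c) = Finset.range (c + d + 1) :=
    Finset.insert_erase (by simp)
  rw [h5] at h1
  rw [h6] at h4
  rw [h7, h4] at h3
  rw [h1, h2, zero_add] at h0
  have i1 : p.interp ξ (c + d + 1) (d + w + 1) = p.word ξ (Finset.range (c + d + 1)) c := by
    rw [interp]; congr 1; omega
  have i2 : p.interp ξ (c + d) (d + w + 1) = p.word ξ (Finset.range (c + d)) c := by
    rw [interp]; congr 1; omega
  have i3 : p.interp ξ (c + d + 1) (d + w) = p.word ξ (Finset.range (c + d + 1)) (c + 1) := by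
    rw [interp]; congr 1; omega
  rw [i1, i2, i3]
  simp only [pow_add, pow_mul', inv_pow] at h0 h3 ⊢
  generalize p.word ξ (Finset.range (c + d + 1)) c = w₁ at *
  generalize p.word ξ (Finset.range (c + d)) c = w₂ at *
  generalize p.word ξ (Finset.range (c + d + 1)) (c + 1) = w₃ at *
  generalize p.word ξ ((Finset.range (c + d + 1)).erase c) (c + 1) = w₄ at *
  have hK : p.t ^ c ≠ 0 := pow_ne_zero _ ht
  have hD : p.t ^ d ≠ 0 := pow_ne_zero _ ht
  have hJ : p.t ^ w ≠ 0 := pow_ne_zero _ ht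
  generalize p.t ^ c = K at *
  generalize p.t ^ d = D at *
  generalize p.t ^ w = J at *
  have h8 : w₄ = D⁻¹ * w₂ - p.b₂ * w₁ + p.a₁⁻¹ * w₃ := by
    field_simp at h3 ⊢
    linear_combination h3
  rw [h8] at h0
  rw [← sub_eq_zero] at h0 ⊢
  rw [← mul_zero (-(p.a₂ * J)), ← h0]
  field_simp
  ring

end SelbergParams

/-! ### Gaussian binomials and the coefficients solving the recurrences -/

section Gauss

/-- The symmetric form `(t;t)_{m+r} / ((t;t)_m (t;t)_r)` of the Gaussian binomial. -/
def gauss (t : ℂ) (m r : ℕ) : ℂ := qPoch t t (m + r) / (qPoch t t m * qPoch t t r)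

theorem qPoch_self_ne_zero {t : ℂ} {n k : ℕ} (ht : ∀ k : ℕ, 1 ≤ k → k ≤ n → t ^ k ≠ 1)
    (hk : k ≤ n) : qPoch t t k ≠ 0 := by
  refine Finset.prod_ne_zero_iff.2 fun i hi h => ?_
  have := Finset.mem_range.1 hi
  exact ht (i + 1) (by omega) (by omega) (by rw [pow_succ]; exact (sub_eq_zero.1 h).symm)

theorem qPoch_add (c x : ℂ) (k l : ℕ) :
    qPoch c x (k + l) = qPoch c x k * qPoch c (x * c ^ k) l := by
  unfold qPoch
  rw [Finset.prod_range_add]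
  congr 1
  exact Finset.prod_congr rfl fun i _ => by ring

variable {t : ℂ} {n : ℕ}

theorem gauss_zero_left (ht : ∀ k : ℕ, 1 ≤ k → k ≤ n → t ^ k ≠ 1) {r : ℕ} (hr : r ≤ n) :
    gauss t 0 r = 1 := by
  simp [gauss, qPoch_self_ne_zero ht hr]

theorem gauss_zero_right (ht : ∀ k : ℕ, 1 ≤ k → k ≤ n → t ^ k ≠ 1) {m : ℕ} (hm : m ≤ n) :
    gauss t m 0 = 1 := by
  simp [gauss, qPoch_self_ne_zero ht hm]

theorem gauss_pascal (ht : ∀ k : ℕ, 1 ≤ k → k ≤ n → t ^ k ≠ 1) {m r : ℕ} (h : m + r + 2 ≤ n) :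
    gauss t (m + 1) (r + 1) = gauss t m (r + 1) + t ^ (m + 1) * gauss t (m + 1) r := by
  have h1 := qPoch_self_ne_zero ht (k := m + 1) (by omega)
  have h2 := qPoch_self_ne_zero ht (k := r + 1) (by omega)
  have e : m + 1 + (r + 1) = m + r + 1 + 1 := by ring
  have e1 : m + (r + 1) = m + r + 1 := by ring
  have e2 : m + 1 + r = m + r + 1 := by ring
  have key : 1 - t ^ (m + r + 1) * t = (1 - t ^ m * t) + t ^ (m + 1) * (1 - t ^ r * t) := by ring
  unfold gauss
  rw [e, e1, e2, qPoch_succ t t (m + r + 1), key]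
  rw [qPoch_succ] at h1 h2
  rw [qPoch_succ t t r, qPoch_succ t t m]
  obtain ⟨h3, h4⟩ := mul_ne_zero_iff.1 h1
  obtain ⟨h5, h6⟩ := mul_ne_zero_iff.1 h2
  clear key h1 h2
  generalize 1 - t ^ m * t = D₁ at *
  generalize 1 - t ^ r * t = D₂ at *
  field_simp

theorem gauss_pascal' (ht : ∀ k : ℕ, 1 ≤ k → k ≤ n → t ^ k ≠ 1) {m r : ℕ} (h : m + r + 2 ≤ n) :
    gauss t (m + 1) (r + 1) = t ^ (r + 1) * gauss t m (r + 1) + gauss t (m + 1) r := by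
  have hs : ∀ a b, gauss t a b = gauss t b a := fun a b => by
    rw [gauss, gauss, add_comm, mul_comm (qPoch t t a)]
  rw [hs, gauss_pascal ht (by omega), hs r, hs (r + 1) m]
  ring

/-- The summation step common to the expansions below. -/
theorem sum_antidiagonal_step {f a b : ℕ → ℕ → ℂ} (v : ℕ → ℂ) (k : ℕ)
    (h0 : f 0 (k + 1) = a 0 k) (h1 : f (k + 1) 0 = b k 0)
    (h : ∀ m r, m + r + 1 = k → f (m + 1) (r + 1) = a (m + 1) r + b m (r + 1)) :
    ∑ x ∈ Finset.HasAntidiagonal.antidiagonal (k + 1), f x.1 x.2 * v x.1 =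
      ∑ x ∈ Finset.HasAntidiagonal.antidiagonal k, a x.1 x.2 * v x.1 +
        ∑ x ∈ Finset.HasAntidiagonal.antidiagonal k, b x.1 x.2 * v (x.1 + 1) := by
  cases k with
  | zero => simp [Finset.Nat.sum_antidiagonal_succ, h0, h1]
  | succ k =>
    rw [Finset.Nat.sum_antidiagonal_succ, Finset.Nat.sum_antidiagonal_succ',
      Finset.Nat.sum_antidiagonal_succ (f := fun x => a x.1 x.2 * v x.1),
      Finset.Nat.sum_antidiagonal_succ' (f := fun x => b x.1 x.2 * v (x.1 + 1)), h0, h1]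
    have : ∑ x ∈ Finset.HasAntidiagonal.antidiagonal k, f (x.1 + 1) (x.2 + 1) * v (x.1 + 1) =
        ∑ x ∈ Finset.HasAntidiagonal.antidiagonal k, a (x.1 + 1) x.2 * v (x.1 + 1) +
          ∑ x ∈ Finset.HasAntidiagonal.antidiagonal k, b x.1 (x.2 + 1) * v (x.1 + 1) := by
      rw [← Finset.sum_add_distrib]
      refine Finset.sum_congr rfl fun x hx => ?_
      have := Finset.HasAntidiagonal.mem_antidiagonal.1 hx
      rw [h _ _ (by omega)]
      ring
    simp only at this ⊢
    rw [this]
    ring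

/-- Coefficients of the expansion behind the lower triangular factor. -/
def lowerCoeff (t X Y : ℂ) (w j m r : ℕ) : ℂ :=
  t ^ (w * (m + r) + r.choose 2) * (-1) ^ m * gauss t m r * qPoch t (Y * t ^ j) m *
    qPoch t (X * t ^ (w + 2 * j + m)) r

theorem lowerCoeff_zero_succ (ht : ∀ k : ℕ, 1 ≤ k → k ≤ n → t ^ k ≠ 1) (X Y : ℂ) (w j : ℕ) {r : ℕ}
    (h : r + 1 ≤ n) : lowerCoeff t X Y w j 0 (r + 1) =
      t ^ w * (1 - X * t ^ (w + 2 * j)) * lowerCoeff t X Y (w + 1) j 0 r := by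
  unfold lowerCoeff
  rw [gauss_zero_left ht h, gauss_zero_left ht (by omega : r ≤ n), qPoch_succ',
    Nat.choose_succ_succ' r 1, Nat.choose_one_right]
  have e : X * t ^ (w + 2 * j + 0) * t = X * t ^ (w + 1 + 2 * j + 0) := by ring
  rw [e]
  simp only [qPoch_zero]
  ring

theorem lowerCoeff_succ_zero (ht : ∀ k : ℕ, 1 ≤ k → k ≤ n → t ^ k ≠ 1) (X Y : ℂ) (w j : ℕ) {m : ℕ}
    (h : m + 1 ≤ n) : lowerCoeff t X Y w j (m + 1) 0 =
      -(t ^ w * (1 - Y * t ^ j)) * lowerCoeff t X Y w (j + 1) m 0 := by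
  unfold lowerCoeff
  rw [gauss_zero_right ht h, gauss_zero_right ht (by omega : m ≤ n), qPoch_succ']
  have e : Y * t ^ j * t = Y * t ^ (j + 1) := by ring
  rw [e]
  simp only [qPoch_zero]
  ring

/-- The first Pascal rule minus `X t^(w+2j+m+1)` times the second makes the two linear factors in
`X` appear; the other factors match one by one. -/
theorem lowerCoeff_succ_succ (ht : ∀ k : ℕ, 1 ≤ k → k ≤ n → t ^ k ≠ 1) (X Y : ℂ) (w j : ℕ)
    {m r : ℕ} (h : m + r + 2 ≤ n) : lowerCoeff t X Y w j (m + 1) (r + 1) =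
      t ^ w * (1 - X * t ^ (w + 2 * j)) * lowerCoeff t X Y (w + 1) j (m + 1) r +
      -(t ^ w * (1 - Y * t ^ j)) * lowerCoeff t X Y w (j + 1) m (r + 1) := by
  unfold lowerCoeff
  have e1 : Y * t ^ j * t = Y * t ^ (j + 1) := by ring
  have e2 : X * t ^ (w + 1 + 2 * j + (m + 1)) = X * t ^ (w + 2 * j + (m + 1)) * t := by ring
  have e3 : X * t ^ (w + 2 * (j + 1) + m) = X * t ^ (w + 2 * j + (m + 1)) * t := by ring
  rw [qPoch_succ' t (Y * t ^ j), e1, e2, e3, qPoch_succ' t (X * t ^ (w + 2 * j + (m + 1))),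
    qPoch_succ t (X * t ^ (w + 2 * j + (m + 1)) * t), Nat.choose_succ_succ' r 1,
    Nat.choose_one_right]
  generalize qPoch t (X * t ^ (w + 2 * j + (m + 1)) * t) r = P
  generalize qPoch t (Y * t ^ (j + 1)) m = R
  have p1 := gauss_pascal ht h
  have p2 := gauss_pascal' ht h
  generalize gauss t (m + 1) (r + 1) = g at *
  generalize gauss t m (r + 1) = g₁ at *
  generalize gauss t (m + 1) r = g₂ at *
  have key : g * (1 - X * t ^ (w + 2 * j + (m + 1))) = t ^ (m + 1) * g₂ * (1 - X * t ^ (w + 2 * j)) +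
      g₁ * (1 - X * t ^ (w + 2 * j + (m + 1)) * t * t ^ r) := by
    linear_combination p1 - X * t ^ (w + 2 * j + (m + 1)) * p2
  linear_combination t ^ (w * (m + 1 + (r + 1)) + (r + r.choose 2)) * (-1) ^ (m + 1) *
    (1 - Y * t ^ j) * R * P * key

/-- Coefficients of the expansion behind the upper triangular factor. -/
def upperCoeff (t a V x W X : ℂ) (u w c d : ℕ) : ℂ :=
  a ^ c * t ^ (w * (c + 2 * d) + (c + d).choose 2) * qPoch t (x * t ^ w) c * V ^ d * gauss t c d *
    qPoch t (W * t ^ u) d /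
      -- The natural subtraction truncates only for `w = c = 0`, where the shifted factorial is
      -- empty.
      (qPoch t (X * t ^ (2 * w + c - 1)) c * qPoch t (X * t ^ (2 * w + 2 * c)) d)

theorem qPoch_ne_zero_of_forall {X : ℂ} {s k M : ℕ} (hX : ∀ m : ℕ, m + 1 < M → X * t ^ m ≠ 1)
    (h : s + k < M) : qPoch t (X * t ^ s) k ≠ 0 := by
  refine Finset.prod_ne_zero_iff.2 fun i hi h0 => ?_
  have := Finset.mem_range.1 hi
  refine hX (s + i) (by omega) ?_
  rw [pow_add, ← mul_assoc]
  linear_combination -h0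

theorem one_sub_ne_zero_of_forall {X : ℂ} {s M : ℕ} (hX : ∀ m : ℕ, m + 1 < M → X * t ^ m ≠ 1)
    (h : s + 1 < M) : 1 - X * t ^ s ≠ 0 := fun h0 => hX s h (by linear_combination -h0)

variable {X : ℂ}

theorem upperCoeff_zero_succ (ht : ∀ k : ℕ, 1 ≤ k → k ≤ n → t ^ k ≠ 1)
    (hX : ∀ m : ℕ, m + 1 < 2 * n → X * t ^ m ≠ 1) (a V x W : ℂ) (u w : ℕ) {d : ℕ}
    (h : w + d + 1 ≤ n) :
    (1 - X * t ^ (2 * w + d)) * upperCoeff t a V x W X u w 0 (d + 1) =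
      V * t ^ (2 * w + d) * (1 - W * t ^ u) * upperCoeff t a V x W X (u + 1) w 0 d := by
  unfold upperCoeff
  have e1 : W * t ^ u * t = W * t ^ (u + 1) := by ring
  have e2 : t ^ d * (X * t ^ (2 * w)) = X * t ^ (2 * w + d) := by ring
  rcases Nat.eq_zero_or_pos (w + d) with h0 | h0
  · obtain ⟨rfl, rfl⟩ : w = 0 ∧ d = 0 := by omega
    have h1 : 1 - X ≠ 0 := by
      simpa using one_sub_ne_zero_of_forall hX (s := 0) (by omega)
    simp [gauss_zero_left ht h, gauss_zero_left ht (Nat.zero_le n), qPoch_succ]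
    field_simp
  have h1 : 1 - X * t ^ (2 * w + d) ≠ 0 := one_sub_ne_zero_of_forall hX (by omega)
  have h2 : qPoch t (X * t ^ (2 * w)) d ≠ 0 := qPoch_ne_zero_of_forall hX (by omega)
  rw [gauss_zero_left ht (by omega : d + 1 ≤ n), gauss_zero_left ht (by omega : d ≤ n),
    qPoch_succ' t (W * t ^ u), e1]
  simp only [qPoch_zero, mul_zero, add_zero, zero_add]
  rw [qPoch_succ t (X * t ^ (2 * w)), e2, Nat.choose_succ_succ' d 1, Nat.choose_one_right]
  generalize 1 - X * t ^ (2 * w + d) = D at *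
  generalize qPoch t (X * t ^ (2 * w)) d = P at *
  generalize qPoch t (W * t ^ (u + 1)) d = R at *
  field_simp
  ring

theorem upperCoeff_succ_zero (ht : ∀ k : ℕ, 1 ≤ k → k ≤ n → t ^ k ≠ 1)
    (hX : ∀ m : ℕ, m + 1 < 2 * n → X * t ^ m ≠ 1) (a V x W : ℂ) (u w : ℕ) {c : ℕ}
    (h : w + c + 1 ≤ n) :
    (1 - X * t ^ (2 * w + c)) * upperCoeff t a V x W X u w (c + 1) 0 =
      a * t ^ w * (1 - x * t ^ w) * upperCoeff t a V x W X u (w + 1) c 0 := by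
  unfold upperCoeff
  have e1 : x * t ^ w * t = x * t ^ (w + 1) := by ring
  have e2 : X * t ^ (2 * w + c) * t = X * t ^ (2 * w + c + 1) := by ring
  have e3 : 2 * w + (c + 1) - 1 = 2 * w + c := by omega
  have e4 : 2 * (w + 1) + c - 1 = 2 * w + c + 1 := by omega
  have h1 : 1 - X * t ^ (2 * w + c) ≠ 0 := one_sub_ne_zero_of_forall hX (by omega)
  have h2 : qPoch t (X * t ^ (2 * w + c + 1)) c ≠ 0 := by
    rcases Nat.eq_zero_or_pos c with rfl | hc
    · simp
    · exact qPoch_ne_zero_of_forall hX (by omega)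
  rw [gauss_zero_right ht (by omega : c + 1 ≤ n), gauss_zero_right ht (by omega : c ≤ n),
    qPoch_succ' t (x * t ^ w), e1, e3, e4, qPoch_succ' t (X * t ^ (2 * w + c)), e2]
  simp only [qPoch_zero, add_zero, mul_zero]
  rw [Nat.choose_succ_succ' c 1, Nat.choose_one_right]
  generalize 1 - X * t ^ (2 * w + c) = D at *
  generalize qPoch t (X * t ^ (2 * w + c + 1)) c = P at *
  generalize qPoch t (x * t ^ (w + 1)) c = R at *
  field_simp
  ring

theorem upperCoeff_succ_succ (ht : ∀ k : ℕ, 1 ≤ k → k ≤ n → t ^ k ≠ 1)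
    (hX : ∀ m : ℕ, m + 1 < 2 * n → X * t ^ m ≠ 1) (a V x W : ℂ) (u w : ℕ) {c d : ℕ}
    (h : w + c + d + 2 ≤ n) :
    (1 - X * t ^ (2 * w + (c + d + 1))) * upperCoeff t a V x W X u w (c + 1) (d + 1) =
      V * t ^ (2 * w + (c + d + 1)) * (1 - W * t ^ u) *
          upperCoeff t a V x W X (u + 1) w (c + 1) d +
        a * t ^ w * (1 - x * t ^ w) * upperCoeff t a V x W X u (w + 1) c (d + 1) := by
  unfold upperCoeff
  have e1 : x * t ^ w * t = x * t ^ (w + 1) := by ring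
  have e2 : X * t ^ (2 * w + c) * t = X * t ^ (2 * w + c + 1) := by ring
  have e3 : 2 * w + (c + 1) - 1 = 2 * w + c := by omega
  have e4 : 2 * (w + 1) + c - 1 = 2 * w + c + 1 := by omega
  have e5 : W * t ^ u * t = W * t ^ (u + 1) := by ring
  have e6 : 2 * (w + 1) + 2 * c = 2 * w + 2 * (c + 1) := by omega
  have e7 : c + 1 + (d + 1) = c + d + 1 + 1 := by omega
  have e8 : c + 1 + d = c + d + 1 := by omega
  have e9 : c + (d + 1) = c + d + 1 := by omega
  have h1 : 1 - X * t ^ (2 * w + c) ≠ 0 := one_sub_ne_zero_of_forall hX (by omega)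
  have h2 : qPoch t (X * t ^ (2 * w + c + 1)) c ≠ 0 := qPoch_ne_zero_of_forall hX (by omega)
  have h3 : qPoch t (X * t ^ (2 * w + 2 * (c + 1))) d ≠ 0 :=
    qPoch_ne_zero_of_forall hX (by omega)
  have h4 : 1 - t ^ d * (X * t ^ (2 * w + 2 * (c + 1))) ≠ 0 := by
    have := one_sub_ne_zero_of_forall hX (s := 2 * w + 2 * (c + 1) + d) (by omega)
    rwa [pow_add, ← mul_assoc, mul_comm (X * _)] at this
  have key : gauss t (c + 1) (d + 1) * (1 - X * t ^ (2 * w + (c + d + 1))) =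
      t ^ (d + 1) * gauss t c (d + 1) * (1 - X * t ^ (2 * w + c)) +
        gauss t (c + 1) d * (1 - t ^ d * (X * t ^ (2 * w + 2 * (c + 1)))) := by
    linear_combination gauss_pascal' ht (m := c) (r := d) (by omega) -
      X * t ^ (2 * w + (c + d + 1)) * gauss_pascal ht (m := c) (r := d) (by omega)
  rw [qPoch_succ' t (x * t ^ w), e1, e3, e4, qPoch_succ' t (X * t ^ (2 * w + c)), e2,
    qPoch_succ' t (W * t ^ u), e5, e6, qPoch_succ t (X * t ^ (2 * w + 2 * (c + 1))), e7, e8, e9,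
    Nat.choose_succ_succ' (c + d + 1) 1, Nat.choose_one_right]
  generalize gauss t (c + 1) (d + 1) = g at *
  generalize gauss t c (d + 1) = g₁ at *
  generalize gauss t (c + 1) d = g₂ at *
  generalize 1 - t ^ d * (X * t ^ (2 * w + 2 * (c + 1))) = D₄ at *
  generalize qPoch t (X * t ^ (2 * w + 2 * (c + 1))) d = D₃ at *
  generalize qPoch t (X * t ^ (2 * w + c + 1)) c = D₂ at *
  generalize 1 - X * t ^ (2 * w + c) = D₁ at *
  generalize 1 - X * t ^ (2 * w + (c + d + 1)) = D at *
  generalize qPoch t (x * t ^ (w + 1)) c = R₁ at *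
  generalize qPoch t (W * t ^ (u + 1)) d = R₂ at *
  generalize 1 - x * t ^ w = S₁ at *
  generalize 1 - W * t ^ u = S₂ at *
  field_simp
  linear_combination a ^ c * a * V ^ d * V * R₁ * R₂ * S₁ * S₂ *
    t ^ (w * (c + 2 * d + 3) + (c + d + 1) + (c + d + 1).choose 2) * key

end Gauss

/-! ### Solution of the recurrences and the factorization -/

namespace SelbergParams

variable {p : SelbergParams} {n : ℕ}

/-- Both words on the right of `interp_lower` carry the same normalizing factorial in the induction,
since it depends on `w` and `j` only through `w + j`. It can therefore stay on the left, and no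
division occurs. -/
theorem interp_lower_expand (hp : p.Good n) (ht : ∀ k : ℕ, 1 ≤ k → k ≤ n → p.t ^ k ≠ 1)
    {ξ : Fin n → ℂ} (hξ : p.Admissible ξ) (k w j : ℕ) (h : k + w + j = n) :
    p.interp ξ k j *
        qPoch p.t (p.qα * p.a₁ * p.a₂ * p.b₁ * p.b₂ * p.t ^ (k + 2 * w + 2 * j - 1)) k =
      p.a₁ ^ k * ∑ x ∈ Finset.HasAntidiagonal.antidiagonal k,
        lowerCoeff p.t (p.qα * p.a₂ * p.b₂) (p.a₂ * p.b₂) w j x.1 x.2 * p.interp ξ 0 (j + x.1) := by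
  induction k generalizing w j with
  | zero => simp [lowerCoeff, gauss]
  | succ k ih =>
    have h0 := interp_lower hp hξ (k := k) (d := w) (j := j) (by omega)
    have h1 := ih (w + 1) j (by omega)
    have h2 := ih w (j + 1) (by omega)
    have step := sum_antidiagonal_step
      (f := lowerCoeff p.t (p.qα * p.a₂ * p.b₂) (p.a₂ * p.b₂) w j)
      (a := fun m r => p.t ^ w * (1 - p.qα * p.a₂ * p.b₂ * p.t ^ (w + 2 * j)) *
        lowerCoeff p.t (p.qα * p.a₂ * p.b₂) (p.a₂ * p.b₂) (w + 1) j m r)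
      (b := fun m r => -(p.t ^ w * (1 - p.a₂ * p.b₂ * p.t ^ j)) *
        lowerCoeff p.t (p.qα * p.a₂ * p.b₂) (p.a₂ * p.b₂) w (j + 1) m r)
      (fun m => p.interp ξ 0 (j + m)) k
      (lowerCoeff_zero_succ ht _ _ _ _ (by omega)) (lowerCoeff_succ_zero ht _ _ _ _ (by omega))
      fun m r hmr => lowerCoeff_succ_succ ht _ _ _ _ (by omega)
    have hj : ∀ x : ℕ × ℕ, j + (x.1 + 1) = j + 1 + x.1 := fun x => by ring
    simp only [hj, mul_assoc _ (lowerCoeff _ _ _ _ _ _ _), ← Finset.mul_sum] at step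
    have e1 : k + 1 + 2 * w + 2 * j - 1 = k + 2 * w + 2 * j := by omega
    have e2 : k + 2 * (w + 1) + 2 * j - 1 = k + 2 * w + 2 * j + 1 := by omega
    have e3 : k + 2 * w + 2 * (j + 1) - 1 = k + 2 * w + 2 * j + 1 := by omega
    rw [e2] at h1
    rw [e3] at h2
    rw [e1, step, qPoch_succ', mul_assoc _ (p.t ^ _) p.t, ← pow_succ]
    linear_combination qPoch p.t (p.qα * p.a₁ * p.a₂ * p.b₁ * p.b₂ *
        p.t ^ (k + 2 * w + 2 * j + 1)) k * h0 +
      p.a₁ * p.t ^ w * (1 - p.qα * p.a₂ * p.b₂ * p.t ^ (w + 2 * j)) * h1 -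
      p.a₁ * p.t ^ w * (1 - p.a₂ * p.b₂ * p.t ^ j) * h2

/-- Here the linear factor cancelled at each step is one of those that `hden` keeps away from zero.
The recursion stops on the antidiagonal, at `N = 0`. -/
theorem interp_upper_expand (hp : p.Good n) (ht : ∀ k : ℕ, 1 ≤ k → k ≤ n → p.t ^ k ≠ 1)
    (hden : ∀ m : ℕ, m + 1 < 2 * n → p.qα * p.a₂ * p.b₂ * p.t ^ m ≠ 1)
    {ξ : Fin n → ℂ} (hξ : p.Admissible ξ) (N w u : ℕ) (h : w + N + u = n) :
    p.interp ξ (u + N) (w + N) = ∑ x ∈ Finset.HasAntidiagonal.antidiagonal N,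
      upperCoeff p.t p.a₂ (-(p.qα * p.a₁⁻¹ * p.a₂)) p.qα (p.a₁ * p.b₁) (p.qα * p.a₂ * p.b₂) u w
        x.1 x.2 * p.interp ξ (n - (w + x.1)) (w + x.1) := by
  induction N generalizing w u with
  | zero =>
    obtain rfl : n - w = u := by omega
    simp [upperCoeff, gauss]
  | succ N ih =>
    have h0 := interp_upper hp hξ (c := u) (d := N) (w := w) (by omega)
    have h1 := ih (w + 1) u (by omega)
    have h2 := ih w (u + 1) (by omega)
    set μ := upperCoeff p.t p.a₂ (-(p.qα * p.a₁⁻¹ * p.a₂)) p.qα (p.a₁ * p.b₁) (p.qα * p.a₂ * p.b₂)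
    have step := sum_antidiagonal_step
      (f := fun c d => (1 - p.qα * p.a₂ * p.b₂ * p.t ^ (2 * w + N)) * μ u w c d)
      (a := fun c d => -(p.qα * p.a₁⁻¹ * p.a₂) * p.t ^ (2 * w + N) *
        (1 - p.a₁ * p.b₁ * p.t ^ u) * μ (u + 1) w c d)
      (b := fun c d => p.a₂ * p.t ^ w * (1 - p.qα * p.t ^ w) * μ u (w + 1) c d)
      (fun c => p.interp ξ (n - (w + c)) (w + c)) N
      (upperCoeff_zero_succ ht hden _ _ _ _ _ _ (by omega))
      (upperCoeff_succ_zero ht hden _ _ _ _ _ _ (by omega))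
      fun c d hcd => by
        subst hcd
        exact upperCoeff_succ_succ ht hden _ _ _ _ _ _ (by omega)
    have hj : ∀ x : ℕ × ℕ, w + (x.1 + 1) = w + 1 + x.1 := fun x => by ring
    simp only [hj, mul_assoc _ (μ _ _ _ _), ← Finset.mul_sum] at step
    rw [← h1, ← h2] at step
    have hD : 1 - p.qα * p.a₂ * p.b₂ * p.t ^ (2 * w + N) ≠ 0 :=
      one_sub_ne_zero_of_forall hden (by omega)
    refine mul_left_cancel₀ hD ?_
    rw [step]
    have i1 : p.interp ξ (u + (N + 1)) (w + (N + 1)) = p.interp ξ (u + N + 1) (N + w + 1) := by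
      congr 1; ring
    have i2 : p.interp ξ (u + N) (w + 1 + N) = p.interp ξ (u + N) (N + w + 1) := by
      congr 1; ring
    have i3 : p.interp ξ (u + 1 + N) (w + N) = p.interp ξ (u + N + 1) (N + w) := by
      congr 1 <;> ring
    rw [i1, i2, i3, add_comm (2 * w) N]
    linear_combination h0

/-- The nonvanishing of these denominators of `d_j` follows from convergence: the modulus exceeds
`1` at the exponents `0` and `2n - 2`, hence at all exponents between. -/
theorem Good.mul_pow_ne_one (hp : p.Good n) {m : ℕ} (hm : m + 1 < 2 * n) :
    p.qα * p.a₁ * p.a₂ * p.b₁ * p.b₂ * p.t ^ m ≠ 1 := fun h => by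
  have h1 := hp.one_lt_mul (by omega)
  rw [← pow_mul] at h1
  have h2 := one_lt_mul_pow_of_le (zero_lt_one.trans hp.one_lt)
    (norm_pos_iff.2 (t_ne_zero hp.q_ne)) (s := m) (N := 2 * (n - 1)) (by omega) hp.one_lt h1
  rw [← norm_pow, ← norm_mul, h] at h2
  simp at h2

theorem matsuoKernel_eq (i : ℕ) :
    (matsuoKernel p.t p.a₁ p.b₂ i : (Fin n → ℂ) → ℂ) =
      wordKernel p.t fun k : Fin n => p.letter (Finset.range 0) (n - i) k := by
  ext z
  unfold matsuoKernel wordKernel tVdm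
  congr 1
  refine Finset.prod_congr rfl fun k _ => ?_
  have : (k : ℕ) + i < n ↔ (k : ℕ) < n - i := by omega
  simp [letter, this]

theorem prod_mul_matsuoKernel (i : ℕ) (z : Fin n → ℂ) :
    (∏ k, z k) * matsuoKernel p.t p.a₁ p.b₂ i z =
      wordKernel p.t (fun k : Fin n => p.letter (Finset.range n) (n - i) k) z := by
  unfold matsuoKernel wordKernel tVdm
  rw [← mul_assoc, ← Finset.prod_mul_distrib]
  congr 1
  refine Finset.prod_congr rfl fun k _ => ?_
  have : (k : ℕ) + i < n ↔ (k : ℕ) < n - i := by omega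
  simp [letter, this]

theorem integrand_matsuo (ξ : Fin n → ℂ) (i : ℕ) (ν : Fin n → ℤ) :
    p.integrand (matsuo p.t p.a₁ p.b₂ i) ξ ν =
      skewSymm (wordKernel p.t fun k : Fin n => p.letter (Finset.range 0) (n - i) k) (p.pt ξ ν) *
        p.Phi ξ ν := by
  rw [integrand, mul_right_comm, matsuo_mul_vdm, matsuoKernel_eq]

/-- Along the lattice branch, raising `α` by one multiplies `z_i^α` by exactly `z_i`, and no other
factor of `Φ` contains `α`. -/
theorem shift_Phi (hq0 : p.q ≠ 0) {ξ : Fin n → ℂ} (hξ : ∀ i, ξ i ≠ 0) (ν : Fin n → ℤ) :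
    p.shift.Phi ξ ν = (∏ i, p.pt ξ ν i) * p.Phi ξ ν := by
  have h : ∀ i, p.shift.PhiOne (ξ i) (ν i) = p.pt ξ ν i * p.PhiOne (ξ i) (ν i) := fun i => by
    have : p.shift.latPow (ξ i) (ν i) p.shift.α = p.pt ξ ν i * p.latPow (ξ i) (ν i) p.α := by
      simp only [latPow, shift, pt]
      rw [Complex.cpow_add _ _ (hξ i), Complex.cpow_add _ _ hq0, Complex.cpow_one,
        Complex.cpow_one, mul_zpow]
      ring
    rw [PhiOne, this, mul_assoc]
    rfl
  rw [Phi_eq, Phi_eq]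
  simp only [h, Finset.prod_mul_distrib]
  rw [mul_assoc]
  rfl

theorem shift_integrand_matsuo (hq0 : p.q ≠ 0) {ξ : Fin n → ℂ} (hξ : ∀ i, ξ i ≠ 0) (i : ℕ)
    (ν : Fin n → ℤ) :
    p.shift.integrand (matsuo p.t p.a₁ p.b₂ i) ξ ν =
      skewSymm (wordKernel p.t fun k : Fin n => p.letter (Finset.range n) (n - i) k) (p.pt ξ ν) *
        p.Phi ξ ν := by
  rw [integrand, mul_right_comm, show p.shift.pt ξ ν = p.pt ξ ν from rfl, matsuo_mul_vdm,
    shift_Phi hq0 hξ, ← mul_assoc]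
  congr 1
  unfold skewSymm
  rw [Finset.sum_mul]
  refine Finset.sum_congr rfl fun σ _ => ?_
  rw [← prod_mul_matsuoKernel]
  simp only [Function.comp_apply]
  rw [Equiv.prod_comp σ]
  ring

theorem row_eq_interp (ξ : Fin n → ℂ) (i : Fin (n + 1)) :
    p.row n ξ i = (1 - p.q) ^ n * p.interp ξ 0 i := by
  simp only [row, jackson, integrand_matsuo]
  rfl

theorem shift_row_eq_interp (hq0 : p.q ≠ 0) {ξ : Fin n → ℂ} (hξ : ∀ i, ξ i ≠ 0)
    (i : Fin (n + 1)) : p.shift.row n ξ i = (1 - p.q) ^ n * p.interp ξ n i := by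
  have h : p.shift.row n ξ i = (1 - p.q) ^ n *
      ∑' ν, p.shift.integrand (matsuo p.t p.a₁ p.b₂ (i : ℕ)) ξ ν := rfl
  simp only [h, shift_integrand_matsuo hq0 hξ]
  rfl

/-- The factor of `d_j` that normalizes the lower triangular expansion. -/
def dLower (p : SelbergParams) (n j : ℕ) : ℂ :=
  p.a₁ ^ (n - j) * p.t ^ (n - j).choose 2 *
    (qPoch p.t (p.qα * p.a₂ * p.b₂ * p.t ^ (2 * j)) (n - j) /
      qPoch p.t (p.qα * p.a₁ * p.a₂ * p.b₁ * p.b₂ * p.t ^ ((n : ℤ) + j - 1)) (n - j))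

/-- The factor of `d_j` that normalizes the upper triangular expansion. -/
def dUpper (p : SelbergParams) (j : ℕ) : ℂ :=
  p.a₂ ^ j * p.t ^ j.choose 2 *
    (qPoch p.t p.qα j / qPoch p.t (p.qα * p.a₂ * p.b₂ * p.t ^ ((j : ℤ) - 1)) j)

theorem dA_eq (p : SelbergParams) (n j : ℕ) : p.dA n j = p.dLower n j * p.dUpper j := by
  unfold dA dLower dUpper
  rw [pow_add, mul_div_mul_comm]
  ring

/-- Passes from the integer exponent `s - 1` to its natural counterpart; they differ only at `s =
0`, where the shifted factorial must be empty. -/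
theorem qPoch_mul_zpow_sub_one (c x : ℂ) (s k : ℕ) (h : k = 0 ∨ 0 < s) :
    qPoch c (x * c ^ ((s : ℤ) - 1)) k = qPoch c (x * c ^ (s - 1)) k := by
  rcases h with rfl | h
  · simp
  · rw [← zpow_natCast, Nat.cast_pred h]

theorem dLower_mul_lA (hp : p.Good n)
    (hden : ∀ m : ℕ, m + 1 < 2 * n → p.qα * p.a₂ * p.b₂ * p.t ^ m ≠ 1) {j m r : ℕ}
    (h : j + m + r = n) :
    p.dLower n j * p.lA n (j + m) j *
        qPoch p.t (p.qα * p.a₁ * p.a₂ * p.b₁ * p.b₂ * p.t ^ (n + j - 1)) (n - j) =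
      p.a₁ ^ (n - j) * lowerCoeff p.t (p.qα * p.a₂ * p.b₂) (p.a₂ * p.b₂) 0 j m r := by
  have ht0 := t_ne_zero hp.q_ne
  have e1 : n - j = m + r := by omega
  have e2 : n - (j + m) = r := by omega
  have e3 : j + m - j = m := by omega
  have hM : qPoch p.t (p.qα * p.a₁ * p.a₂ * p.b₁ * p.b₂ * p.t ^ (n + j - 1)) (m + r) ≠ 0 := by
    rcases Nat.eq_zero_or_pos (m + r) with h0 | h0
    · simp [h0]
    · exact qPoch_ne_zero_of_forall (M := 2 * n) (fun m hm => hp.mul_pow_ne_one hm) (by omega)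
  have hX : qPoch p.t (p.qα * p.a₂ * p.b₂ * p.t ^ (2 * j)) m ≠ 0 := by
    rcases Nat.eq_zero_or_pos m with h0 | h0
    · simp [h0]
    · exact qPoch_ne_zero_of_forall hden (by omega)
  have hb : qBinom p.t (m + r) r = gauss p.t m r := by simp [qBinom, gauss]
  have hz := qPoch_mul_zpow_sub_one p.t (p.qα * p.a₁ * p.a₂ * p.b₁ * p.b₂) (n + j) (m + r)
    (by omega)
  push_cast at hz
  unfold dLower lA lowerCoeff
  rw [if_pos (by omega), e1, e2, e3, hb, hz, qPoch_add _ (_ * p.t ^ (2 * j)) m r,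
    zpow_sub₀ ht0, zpow_natCast, zpow_natCast, zero_mul, zero_add, zero_add,
    pow_add p.t (2 * j) m, ← mul_assoc _ (p.t ^ (2 * j))]
  have hC : p.t ^ ((m + r).choose 2) ≠ 0 := pow_ne_zero _ ht0
  generalize qPoch p.t (p.qα * p.a₁ * p.a₂ * p.b₁ * p.b₂ * p.t ^ (n + j - 1)) (m + r) = M at *
  generalize qPoch p.t (p.qα * p.a₂ * p.b₂ * p.t ^ (2 * j)) m = X₁ at *
  generalize qPoch p.t (p.qα * p.a₂ * p.b₂ * p.t ^ (2 * j) * p.t ^ m) r = X₂ at *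
  generalize p.t ^ ((m + r).choose 2) = T at *
  field_simp

/-- The antidiagonal is the case `w = 0` of the lower expansion; terms with `i < j` are absent,
which is the triangularity of `L_A`. -/
theorem interp_middle_eq (hp : p.Good n) (ht : ∀ k : ℕ, 1 ≤ k → k ≤ n → p.t ^ k ≠ 1)
    (hden : ∀ m : ℕ, m + 1 < 2 * n → p.qα * p.a₂ * p.b₂ * p.t ^ m ≠ 1)
    {ξ : Fin n → ℂ} (hξ : p.Admissible ξ) {j : ℕ} (hj : j ≤ n) :
    p.interp ξ (n - j) j =
      p.dLower n j * ∑ i ∈ Finset.range (n + 1), p.interp ξ 0 i * p.lA n i j := by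
  have hM : qPoch p.t (p.qα * p.a₁ * p.a₂ * p.b₁ * p.b₂ * p.t ^ (n + j - 1)) (n - j) ≠ 0 := by
    rcases Nat.eq_zero_or_pos (n - j) with h0 | h0
    · simp [h0]
    · exact qPoch_ne_zero_of_forall (M := 2 * n) (fun m hm => hp.mul_pow_ne_one hm) (by omega)
  refine mul_right_cancel₀ hM ?_
  have h := interp_lower_expand hp ht hξ (n - j) 0 j (by omega)
  have e1 : n - j + 2 * 0 + 2 * j - 1 = n + j - 1 := by omega
  have e2 : n + 1 = j + (n - j + 1) := by omega
  rw [e1] at h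
  rw [h, e2, Finset.sum_range_add, Finset.sum_eq_zero (s := Finset.range j), zero_add,
    ← Finset.Nat.sum_antidiagonal_eq_sum_range_succ
      (fun m _ => p.interp ξ 0 (j + m) * p.lA n (j + m) j), Finset.mul_sum, Finset.mul_sum,
    Finset.sum_mul]
  · refine Finset.sum_congr rfl fun x hx => ?_
    have := Finset.HasAntidiagonal.mem_antidiagonal.1 hx
    rw [← mul_assoc, ← dLower_mul_lA hp hden (by omega)]
    ring
  · intro i hi
    have := Finset.mem_range.1 hi
    rw [lA, if_neg (by omega), mul_zero]

theorem dUpper_mul_uA (hp : p.Good n) (c d : ℕ) :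
    p.dUpper c * p.uA n c (c + d) =
      upperCoeff p.t p.a₂ (-(p.qα * p.a₁⁻¹ * p.a₂)) p.qα (p.a₁ * p.b₁) (p.qα * p.a₂ * p.b₂)
        (n - (c + d)) 0 c d := by
  have ht0 := t_ne_zero hp.q_ne
  have hb : qBinom p.t (c + d) c = gauss p.t c d := by
    simp [qBinom, gauss, mul_comm]
  have hC : p.t ^ (c.choose 2) ≠ 0 := pow_ne_zero _ ht0
  unfold dUpper uA upperCoeff
  rw [if_pos (by omega), hb, qPoch_mul_zpow_sub_one _ _ _ _ (by omega), zpow_sub₀ ht0,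
    zpow_natCast, zpow_natCast, Nat.add_sub_cancel_left]
  simp only [mul_zero, zero_mul, zero_add, pow_zero, mul_one]
  generalize qPoch p.t (p.qα * p.a₂ * p.b₂ * p.t ^ (c - 1)) c = D₁
  generalize qPoch p.t (p.qα * p.a₂ * p.b₂ * p.t ^ (2 * c)) d = D₂
  generalize p.t ^ (c.choose 2) = T at *
  generalize -(p.qα * p.a₁⁻¹ * p.a₂) = V
  field_simp

theorem interp_top_eq (hp : p.Good n) (ht : ∀ k : ℕ, 1 ≤ k → k ≤ n → p.t ^ k ≠ 1)
    (hden : ∀ m : ℕ, m + 1 < 2 * n → p.qα * p.a₂ * p.b₂ * p.t ^ m ≠ 1)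
    {ξ : Fin n → ℂ} (hξ : p.Admissible ξ) {j : ℕ} (hj : j ≤ n) :
    p.interp ξ n j = ∑ i ∈ Finset.range (n + 1),
      p.interp ξ (n - i) i * (p.dUpper i * p.uA n i j) := by
  have h := interp_upper_expand hp ht hden hξ j 0 (n - j) (by omega)
  rw [Nat.sub_add_cancel hj, zero_add] at h
  have e : n + 1 = (j + 1) + (n - j) := by omega
  rw [h, e, Finset.sum_range_add, Finset.sum_eq_zero (s := Finset.range (n - j)), add_zero,
    ← Finset.Nat.sum_antidiagonal_eq_sum_range_succ
      (fun i _ => p.interp ξ (n - i) i * (p.dUpper i * p.uA n i j))]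
  · refine Finset.sum_congr rfl fun x hx => ?_
    have := Finset.HasAntidiagonal.mem_antidiagonal.1 hx
    subst this
    rw [dUpper_mul_uA hp, zero_add, mul_comm]
  · intro i _
    rw [uA, if_neg (by omega), mul_zero, mul_zero]

theorem isShiftMatrix_mul (hp : p.Good n) (ht : ∀ k : ℕ, 1 ≤ k → k ≤ n → p.t ^ k ≠ 1)
    (hden : ∀ m : ℕ, m + 1 < 2 * n → p.qα * p.a₂ * p.b₂ * p.t ^ m ≠ 1) :
    p.IsShiftMatrix n (p.matL n * p.matD n * p.matU n) := by
  intro ξ hξ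
  have hS : ∀ (Z : Finset ℕ) (c : ℕ), Summable fun ν =>
      skewSymm (wordKernel p.t fun k : Fin n => p.letter Z c k) (p.pt ξ ν) * p.Phi ξ ν :=
    fun Z c => summable_skewSymm_mul_Phi hp hξ (tame_wordKernel _ fun k => quadGrowth_letter _ _ _)
  refine ⟨fun i => ⟨?_, ?_⟩, ?_⟩
  · exact (hS _ _).congr fun ν => (integrand_matsuo ξ i ν).symm
  · exact (hS _ _).congr fun ν => (shift_integrand_matsuo hp.q_ne hξ.1 i ν).symm
  -- The intermediate vector: the original row times `L_A` and the first diagonal factor is the row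
  -- of antidiagonal words. Applying `dUpper` and `U_A` then gives the shifted row.
  · have hL : ∀ i : Fin (n + 1), Matrix.vecMul (p.row n ξ) (p.matL n) i * p.dLower n i =
        (1 - p.q) ^ n * p.interp ξ (n - i) i := fun i => by
      rw [interp_middle_eq hp ht hden hξ (Nat.lt_succ_iff.1 i.2), Finset.sum_range]
      simp only [Matrix.vecMul, dotProduct, matL, Matrix.of_apply, row_eq_interp, mul_assoc]
      rw [← Finset.mul_sum]
      ring
    ext j
    rw [← Matrix.vecMul_vecMul, ← Matrix.vecMul_vecMul, shift_row_eq_interp hp.q_ne hξ.1,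
      interp_top_eq hp ht hden hξ (Nat.lt_succ_iff.1 j.2), Finset.sum_range, Finset.mul_sum]
    rw [Matrix.vecMul, dotProduct]
    refine Finset.sum_congr rfl fun i _ => ?_
    have hU : p.matU n i j = p.uA n i j := rfl
    rw [matD, Matrix.vecMul_diagonal, dA_eq, hU]
    linear_combination -(p.dUpper i * p.uA n i j) * hL i

/-! ### The determinant -/

theorem det_mul_eq_prod_dA (ht : ∀ k : ℕ, 1 ≤ k → k ≤ n → p.t ^ k ≠ 1) :
    (p.matL n * p.matD n * p.matU n).det = ∏ j ∈ Finset.range (n + 1), p.dA n j := by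
  have hL : (p.matL n).det = 1 := by
    rw [Matrix.det_of_isLowerTriangular]
    · refine Finset.prod_eq_one fun i _ => ?_
      have := qPoch_self_ne_zero ht (k := n - i) (by omega)
      simp [matL, lA, qBinom, this]
    · intro i j hij
      have : (i : ℕ) < j := hij
      rw [matL, Matrix.of_apply, lA, if_neg (by omega)]
  have hU : (p.matU n).det = 1 := by
    rw [Matrix.det_of_isUpperTriangular]
    · refine Finset.prod_eq_one fun i _ => ?_
      have := qPoch_self_ne_zero ht (k := i) (by omega)
      simp [matU, uA, qBinom, this]
    · intro i j hij
      have : (j : ℕ) < i := hij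
      rw [matU, Matrix.of_apply, uA, if_neg (by omega)]
  rw [Matrix.det_mul, Matrix.det_mul, hL, hU, one_mul, mul_one, matD, Matrix.det_diagonal,
    Finset.prod_range]

theorem sum_range_choose_succ (n k : ℕ) :
    ∑ j ∈ Finset.range (n + 1), j.choose k = (n + 1).choose (k + 1) := by
  induction n with
  | zero =>
    rw [Finset.sum_range_one, Nat.choose_succ_succ', Nat.choose_zero_succ, add_zero]
  | succ n ih => rw [Finset.sum_range_succ, ih, Nat.choose_succ_succ' (n + 1) k, add_comm]

theorem prod_range_sub {M : Type*} [CommMonoid M] (n : ℕ) (f : ℕ → M) :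
    ∏ j ∈ Finset.range (n + 1), f (n - j) = ∏ j ∈ Finset.range (n + 1), f j := by
  rw [← Finset.prod_range_reflect f]
  exact Finset.prod_congr rfl fun j _ => by congr 1

/-- Two ways of reading one triangle of factors. Passing from `n` to `n + 1` adds on the left one
factor with exponent `n + j` for each `j ≤ n`, which together form `(X t^n; t)_{n+1}`. It makes the
factors with `q^α a₂ b₂` cancel from the determinant. -/
theorem prod_qPoch_triangle (t X : ℂ) (n : ℕ) :
    ∏ j ∈ Finset.range n, qPoch t (X * t ^ (2 * j)) (n - j) =
      ∏ j ∈ Finset.range n, qPoch t (X * t ^ j) (j + 1) := by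
  induction n with
  | zero => rfl
  | succ n ih =>
    rw [Finset.prod_range_succ (fun j => qPoch t (X * t ^ j) (j + 1)) n, ← ih]
    have h : ∀ j ∈ Finset.range (n + 1), qPoch t (X * t ^ (2 * j)) (n + 1 - j) =
        qPoch t (X * t ^ (2 * j)) (n - j) * (1 - t ^ j * (X * t ^ n)) := fun j hj => by
      have hj' := Nat.lt_succ_iff.1 (Finset.mem_range.1 hj)
      rw [Nat.succ_sub hj', qPoch_succ]
      congr 2
      have : t ^ (n - j) * t ^ (2 * j) = t ^ j * t ^ n := by
        rw [← pow_add, ← pow_add]; congr 1; omega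
      linear_combination X * this
    have h' : ∏ j ∈ Finset.range n, qPoch t (X * t ^ (2 * j)) (n - j) =
        ∏ j ∈ Finset.range (n + 1), qPoch t (X * t ^ (2 * j)) (n - j) := by
      rw [Finset.prod_range_succ, Nat.sub_self, qPoch_zero, mul_one]
    rw [Finset.prod_congr rfl h, Finset.prod_mul_distrib, h']
    rfl

theorem prod_dA_eq (hden : ∀ m : ℕ, m + 1 < 2 * n → p.qα * p.a₂ * p.b₂ * p.t ^ m ≠ 1) :
    ∏ j ∈ Finset.range (n + 1), p.dA n j =
      (p.a₁ * p.a₂) ^ ((n + 1).choose 2) * p.t ^ (2 * (n + 1).choose 3) *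
        ∏ i ∈ Finset.Icc 1 n, qPoch p.t p.qα i /
          qPoch p.t (p.qα * p.a₁ * p.a₂ * p.b₁ * p.b₂ * p.t ^ (2 * (n : ℤ) - i - 1)) i := by
  have h1 : ∏ j ∈ Finset.range (n + 1), p.a₂ ^ j = p.a₂ ^ ((n + 1).choose 2) := by
    rw [Finset.prod_pow_eq_pow_sum, ← sum_range_choose_succ n 1]
    simp
  have h2 : ∏ j ∈ Finset.range (n + 1), p.a₁ ^ (n - j) = p.a₁ ^ ((n + 1).choose 2) := by
    rw [prod_range_sub n fun j => p.a₁ ^ j, Finset.prod_pow_eq_pow_sum,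
      ← sum_range_choose_succ n 1]
    simp
  have h3 : ∏ j ∈ Finset.range (n + 1), p.t ^ (j.choose 2 + (n - j).choose 2) =
      p.t ^ (2 * (n + 1).choose 3) := by
    simp only [pow_add, Finset.prod_mul_distrib]
    rw [prod_range_sub n fun j => p.t ^ j.choose 2, Finset.prod_pow_eq_pow_sum,
      sum_range_choose_succ n 2, ← pow_add, two_mul]
  have h4 : ∏ j ∈ Finset.range (n + 1), qPoch p.t (p.qα * p.a₂ * p.b₂ * p.t ^ (2 * j)) (n - j) =
      ∏ j ∈ Finset.range (n + 1), qPoch p.t (p.qα * p.a₂ * p.b₂ * p.t ^ ((j : ℤ) - 1)) j := by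
    rw [Finset.prod_range_succ, Nat.sub_self, qPoch_zero, mul_one, prod_qPoch_triangle,
      Finset.prod_range_succ', qPoch_zero, mul_one]
    exact Finset.prod_congr rfl fun j _ => by simp
  -- The cancelled product must be nonzero; its exponents stay at most `2n - 2`, the range covered
  -- by `hden`.
  have h5 : ∏ j ∈ Finset.range (n + 1),
        qPoch p.t (p.qα * p.a₂ * p.b₂ * p.t ^ ((j : ℤ) - 1)) j ≠ 0 := by
    refine Finset.prod_ne_zero_iff.2 fun j hj => ?_
    have hj' := Finset.mem_range.1 hj
    rcases Nat.eq_zero_or_pos j with rfl | h0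
    · simp
    · rw [qPoch_mul_zpow_sub_one _ _ _ _ (Or.inr h0)]
      exact qPoch_ne_zero_of_forall hden (by omega)
  have h6 : ∏ j ∈ Finset.range (n + 1),
        qPoch p.t (p.qα * p.a₁ * p.a₂ * p.b₁ * p.b₂ * p.t ^ ((n : ℤ) + j - 1)) (n - j) =
      ∏ i ∈ Finset.range (n + 1),
        qPoch p.t (p.qα * p.a₁ * p.a₂ * p.b₁ * p.b₂ * p.t ^ (2 * (n : ℤ) - i - 1)) i := by
    rw [← prod_range_sub n]
    refine Finset.prod_congr rfl fun j hj => ?_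
    have hj' := Nat.lt_succ_iff.1 (Finset.mem_range.1 hj)
    congr 3
    · push_cast [hj']
      ring
    · omega
  have h7 : ∀ f : ℕ → ℂ, f 0 = 1 → ∏ i ∈ Finset.Icc 1 n, f i = ∏ i ∈ Finset.range (n + 1), f i :=
    fun f hf => by
      rw [Finset.range_eq_Ico, Finset.prod_eq_prod_Ico_succ_bot (Nat.succ_pos n), hf, one_mul]
      rfl
  rw [h7 _ (by simp)]
  unfold dA
  simp only [Finset.prod_mul_distrib, Finset.prod_div_distrib]
  rw [h1, h2, h3, h4, h6, mul_comm (∏ j ∈ Finset.range (n + 1), qPoch p.t p.qα j),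
    mul_div_mul_left _ _ h5, mul_pow]

end SelbergParams

end

theorem corollary1p5 (n : ℕ) (p : SelbergParams)
    (hq0 : p.q ≠ 0) (hq1 : ‖p.q‖ < 1)
    (ha₁ : p.a₁ ≠ 0) (ha₂ : p.a₂ ≠ 0) (hb₁ : p.b₁ ≠ 0) (hb₂ : p.b₂ ≠ 0)
    (hconv : p.Converges n) (hconv' : p.shift.Converges n)
    (ht : ∀ k : ℕ, 1 ≤ k → k ≤ n → p.t ^ k ≠ 1)
    (hden : ∀ m : ℕ, m + 1 < 2 * n → p.qα * p.a₂ * p.b₂ * p.t ^ m ≠ 1) :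
    ∃ A : Matrix (Fin (n + 1)) (Fin (n + 1)) ℂ,
      p.IsShiftMatrix n A ∧
      A = p.matL n * p.matD n * p.matU n ∧
      A.det = ∏ j ∈ Finset.range (n + 1), p.dA n j ∧
      A.det = (p.a₁ * p.a₂) ^ ((n + 1).choose 2) * p.t ^ (2 * (n + 1).choose 3) *
        ∏ i ∈ Finset.Icc 1 n, qPoch p.t p.qα i /
          qPoch p.t (p.qα * p.a₁ * p.a₂ * p.b₁ * p.b₂ * p.t ^ (2 * (n : ℤ) - i - 1)) i :=
  have hp : p.Good n := ⟨hq0, hq1, ha₁, ha₂, hb₁, hb₂, hconv, hconv'⟩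
  ⟨p.matL n * p.matD n * p.matU n, SelbergParams.isShiftMatrix_mul hp ht hden, rfl,
    SelbergParams.det_mul_eq_prod_dA ht,
    (SelbergParams.det_mul_eq_prod_dA ht).trans (SelbergParams.prod_dA_eq hden)⟩
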